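/- Let $n\ge 1$ be an integer and let $\lambda>0$, $\mu>0$ be real numbers such that $R=\lambda/\mu$ satisfies $1\le R<n$. Consider the Erlang-C ($M/M/n$) system with arrival rate $\lambda$, $n$ servers and service rate $\mu$, that is, the continuous-time birth-death chain $X$ on $\{0,1,2,\dots\}$ (the number of customers in the system) with birth rate $\lambda$ and death rate $\mu\min(k,n)$ in state $k$. This chain has a unique stationary distribution; let $X(\infty)$ be a random variable with that distribution and let $\tilde X(\infty)=(X(\infty)-R)/\sqrt R$. Put $\zeta=(R-n)/\sqrt R$ and $b(x)=\mu\big[(x+\zeta)^- -\zeta^-\big]$, where $y^-=\max(-y,0)$, and let $Y(\infty)$ be a random variable on $\mathbb R$ with density $$\kappa\exp\Big(\frac1\mu\int_0^x b(y)\,dy\Big),\qquad x\in\mathbb R,$$ where $\kappa>0$ is the normalizing constant. Then $X(\infty)$ and $Y(\infty)$ have finite means, and $$d_W(\tilde X(\infty),Y(\infty))=\sup_{h}\big|\mathbb E\,h(\tilde X(\infty))-\mathbb E\,h(Y(\infty))\big|\le\frac{205}{\sqrt R},$$ where the supremum is over all $h:\mathbb R\to\mathbb R$ with $|h(x)-h(y)|\le|x-y|$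 for all $x,y$. In particular, $$\big|\mathbb E X(\infty)-\big(R+\sqrt R\,\mathbb E Y(\infty)\big)\big|\le 205.$$ -/

import Mathlib

open MeasureTheory ProbabilityTheory Filter Topology
open scoped NNReal ENNReal

noncomputable section

namespace ErlangC

/-- Transition rates of the number of customers in the `M/M/n` (Erlang-C) system with arrival rate
`lam` and service rate `mu`: a birth-death chain on `ℕ` with birth rate `lam` and death rate
`mu * min k n` in state `k`. The diagonal entry is minus the total rate out of the state. -/
def rate (n : ℕ) (lam mu : ℝ) (i j : ℕ) : ℝ :=
  if j = i + 1 then lam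
  else if i = j + 1 then mu * (min i n : ℕ)
  else if i = j then -(lam + mu * (min i n : ℕ))
  else 0

/-- `P` is the transition function of a continuous time Markov chain on `ℕ` with transition
rates `q`: a Markov semigroup whose derivative at time `0` is `q`. -/
structure IsTransitionFunction (q : ℕ → ℕ → ℝ) (P : ℝ≥0 → Kernel ℕ ℕ) : Prop where
  isMarkov : ∀ t, IsMarkovKernel (P t)
  zero : P 0 = Kernel.id
  add : ∀ s t, P (s + t) = P t ∘ₖ P s
  rate : ∀ i j, Tendsto (fun t : ℝ≥0 => ((P t i).real {j} - (P 0 i).real {j}) / (t : ℝ))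
    (𝓝[>] 0) (𝓝 (q i j))

/-- `π` is a stationary distribution of the chain with transition function `P`. -/
def IsStationary (P : ℝ≥0 → Kernel ℕ ℕ) (π : Measure ℕ) : Prop :=
  IsProbabilityMeasure π ∧ ∀ t, (P t).Invariant π

/-- The law of the scaled count `(X - R) / √R`, where `X` has law `π`. -/
def scaledLaw (R : ℝ) (π : Measure ℕ) : Measure ℝ :=
  π.map (fun k : ℕ => ((k : ℝ) - R) / √R)

/-- `ζ = (R - n) / √R` with `R = lam / mu`. -/
def zeta (n : ℕ) (lam mu : ℝ) : ℝ := (lam / mu - n) / √(lam / mu)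

/-- The drift `b(x) = mu * ((x + ζ)⁻ - ζ⁻)` of the diffusion model, with `y⁻ = max (-y) 0`. -/
def drift (n : ℕ) (lam mu x : ℝ) : ℝ :=
  mu * (max (-(x + zeta n lam mu)) 0 - max (-zeta n lam mu) 0)

/-- The unnormalized density `exp ((1 / mu) * ∫₀ˣ b(y) dy)`. -/
def weight (n : ℕ) (lam mu x : ℝ) : ℝ :=
  Real.exp (1 / mu * ∫ y in (0 : ℝ)..x, drift n lam mu y)

/-- The normalizing constant `κ`. -/
def kappa (n : ℕ) (lam mu : ℝ) : ℝ := (∫ x, weight n lam mu x)⁻¹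

/-- The law of `Y(∞)`, with density `κ * exp ((1 / mu) * ∫₀ˣ b(y) dy)`. -/
def diffusionLaw (n : ℕ) (lam mu : ℝ) : Measure ℝ :=
  volume.withDensity (fun x => ENNReal.ofReal (kappa n lam mu * weight n lam mu x))

/-- The Wasserstein distance, as the supremum of `|E h(U) - E h(V)|` over `1`-Lipschitz `h`. It is
meaningful for laws under which all such `h` are integrable. -/
def wasserstein (ν₁ ν₂ : Measure ℝ) : ℝ≥0∞ :=
  ⨆ (h : ℝ → ℝ) (_ : LipschitzWith 1 h), ENNReal.ofReal |(∫ x, h x ∂ν₁) - ∫ x, h x ∂ν₂|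

end ErlangC

end

/-! The proof is Stein's method with a discrete operator. Put z = -ζ = (n - R)/√R > 0 and δ = 1/√R,
so that the density of Y is proportional to `dens z` = exp(-∫₀ˣ min(y, z) dy). For a 1-Lipschitz h
let k = h - E h(Y) and solve g' = min(x, z) g + k.

On the chain's side, detailed balance R a_k = min(k+1, n) a_{k+1} says that E[R u(X+1) - min(X, n)
u(X)] = 0 for u of linear growth. With u = g on the grid x = (X - R)δ and Rδ² = 1, this reads
E[(g(x+δ) - g(x))/δ - min(x, z) g(x)] = 0: exactly the Stein operator, with g' replaced by a forward
difference (`tsum_stein_eq_zero`). Hence E h(scaled X) - E h(Y) is the mean discretization error. By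
the mean value theorem that error is the variation of min(·, z) g + k over a step of length δ, so no
second derivative of g is needed (`exists_discrete_stein_solution`).

With A = E|Y|, a step inside (-∞, z] costs at most (10 + 6A)δ, and a step inside [z, ∞) at most 2δ.
The point z is itself a grid point, the state n, so no step straddles it. Now A ≤ 1 + 1/z
(`integral_abs_mul_dens_le`) blows up in heavy traffic, but the expensive steps occur only in states
below n, whose total probability P is at most min(1, 2z) (`tsum_idle_le`). Thus AP ≤ 3, and the
total is at most 2 + 10 + 18 = 30 times δ.

The remaining work identifies stationarity with detailed balance for an arbitrary transition
function having the given rates. Bounded exit rates make t⁻¹(P_t g - g) uniformly bounded, so the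
generator can be integrated against π (`IsTransitionFunction.integral_generator_eq_zero`,
`IsTransitionFunction.invariant`). Existence of the chain comes from uniformization. -/

noncomputable section

namespace ErlangC

/-! ### The density of the diffusion limit. -/

/-- The potential `∫₀ˣ min y z dy` in closed form. -/
def potential (z x : ℝ) : ℝ := x ^ 2 / 2 - (max (x - z) 0) ^ 2 / 2

/-- The unnormalized density `exp (-∫₀ˣ min y z dy)`. -/
def dens (z x : ℝ) : ℝ := Real.exp (-potential z x)

lemma dens_pos (z x : ℝ) : 0 < dens z x := Real.exp_pos _

/-- Squaring smooths the kink: at 0 the function is O(x²), so the one-sided derivatives agree. -/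
lemma hasDerivAt_max_zero_sq (x : ℝ) :
    HasDerivAt (fun x : ℝ => (max x 0) ^ 2 / 2) (max x 0) x := by
  rcases lt_trichotomy x 0 with hx | rfl | hx
  · rw [max_eq_right hx.le]
    refine (hasDerivAt_const x (0 : ℝ)).congr_of_eventuallyEq ?_
    filter_upwards [Iio_mem_nhds hx] with y hy
    rw [max_eq_right (le_of_lt hy)]; simp
  · rw [hasDerivAt_iff_isLittleO]
    simp only [max_self, sub_zero, smul_zero, ne_eq, OfNat.ofNat_ne_zero, not_false_eq_true,
      zero_pow, zero_div]
    have h : (fun x : ℝ => (max x 0) ^ 2 / 2) =O[𝓝 0] (fun x : ℝ => x ^ 2) := by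
      refine Asymptotics.IsBigO.of_bound 1 (Eventually.of_forall fun y => ?_)
      have : (max y 0) ^ 2 ≤ y ^ 2 := by
        rcases le_total y 0 with h | h
        · rw [max_eq_right h]; nlinarith [sq_nonneg y]
        · rw [max_eq_left h]
      have h0 := sq_nonneg (max y 0)
      rw [Real.norm_of_nonneg (div_nonneg h0 zero_le_two), Real.norm_of_nonneg (sq_nonneg y)]
      linarith
    refine h.trans_isLittleO ?_
    exact Asymptotics.isLittleO_pow_id one_lt_two
  · rw [max_eq_left hx.le]
    have h : HasDerivAt (fun x : ℝ => x ^ 2 / 2) x x := by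
      simpa using (hasDerivAt_pow 2 x).div_const 2
    refine h.congr_of_eventuallyEq ?_
    filter_upwards [Ioi_mem_nhds hx] with y hy
    rw [max_eq_left (le_of_lt hy)]

lemma hasDerivAt_potential (z x : ℝ) : HasDerivAt (potential z) (min x z) x := by
  have h1 : HasDerivAt (fun x : ℝ => x ^ 2 / 2) x x := by
    simpa using (hasDerivAt_pow 2 x).div_const 2
  have h2 := (hasDerivAt_max_zero_sq (x - z)).comp_sub_const x z
  have h3 := h1.sub h2
  have : x - max (x - z) 0 = min x z := by
    rcases le_total x z with h | h
    · rw [max_eq_right (by linarith), min_eq_left h, sub_zero]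
    · rw [max_eq_left (by linarith), min_eq_right h]; ring
  rw [this] at h3
  exact h3

lemma hasDerivAt_dens (z x : ℝ) : HasDerivAt (dens z) (-(min x z) * dens z x) x := by
  have := (hasDerivAt_potential z x).neg.exp
  convert! this using 1
  unfold dens
  simp only [Pi.neg_apply]
  ring

lemma continuous_dens (z : ℝ) : Continuous (dens z) :=
  continuous_iff_continuousAt.2 fun x => (hasDerivAt_dens z x).continuousAt

lemma weight_eq_dens {n : ℕ} {lam mu : ℝ} (hmu : mu ≠ 0) {z : ℝ} (hz : 0 ≤ z)
    (hzeta : zeta n lam mu = -z) : weight n lam mu = dens z := by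
  funext x
  have hd : ∀ y, drift n lam mu y = mu * -(min y z) := by
    intro y
    unfold drift
    rw [hzeta, neg_neg, max_eq_left hz]
    congr 1
    rcases le_total y z with h | h
    · rw [max_eq_left (by linarith), min_eq_left h]; ring
    · rw [max_eq_right (by linarith), min_eq_right h]; ring
  unfold weight dens
  simp_rw [hd]
  rw [intervalIntegral.integral_const_mul, intervalIntegral.integral_neg,
    intervalIntegral.integral_eq_sub_of_hasDerivAt (fun y _ => hasDerivAt_potential z y)
      ((continuous_id.min continuous_const).intervalIntegrable _ _)]
  have : potential z 0 = 0 := by unfold potential; simp [hz]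
  rw [this]
  congr 1
  field_simp
  ring

/-! ### Exponential tails and the first absolute moment. -/

lemma potential_of_le {z x : ℝ} (h : x ≤ z) : potential z x = x ^ 2 / 2 := by
  unfold potential; rw [max_eq_right (by linarith)]; ring

lemma potential_of_ge {z x : ℝ} (h : z ≤ x) : potential z x = z * x - z ^ 2 / 2 := by
  unfold potential; rw [max_eq_left (by linarith)]; ring

/-- AM-GM on the Gaussian side, equality on the exponential side; gives tails of rate z in both
directions. -/
lemma le_potential {z : ℝ} (hz : 0 ≤ z) (x : ℝ) : z * |x| - z ^ 2 / 2 ≤ potential z x := by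
  rcases le_total x z with h | h
  · rw [potential_of_le h]; nlinarith [sq_nonneg (|x| - z), sq_abs x]
  · rw [potential_of_ge h, abs_of_nonneg (hz.trans h)]

lemma dens_le {z : ℝ} (hz : 0 ≤ z) (x : ℝ) :
    dens z x ≤ Real.exp (z ^ 2 / 2) * Real.exp (-(z * |x|)) := by
  rw [← Real.exp_add]
  exact Real.exp_le_exp.2 (by linarith [le_potential hz x])

lemma integral_pow_mul_exp_neg {c : ℝ} (hc : 0 < c) (j : ℕ) :
    ∫ s in Set.Ioi (0 : ℝ), s ^ j * Real.exp (-(c * s)) = j.factorial / c ^ (j + 1) := by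
  have h := Real.integral_rpow_mul_exp_neg_mul_Ioi (a := j + 1) (r := c) (by positivity) hc
  rw [Real.Gamma_nat_eq_factorial] at h
  have e : ∀ s : ℝ, s ^ ((j : ℝ) + 1 - 1) * Real.exp (-(c * s)) = s ^ j * Real.exp (-(c * s)) := by
    intro s; rw [add_sub_cancel_right, Real.rpow_natCast]
  simp_rw [e] at h
  rw [h]
  have : ((1 / c) ^ ((j : ℝ) + 1) : ℝ) = (1 / c) ^ (j + 1) := by
    rw [← Real.rpow_natCast]; norm_cast
  rw [this, one_div, inv_pow]
  ring

lemma integrableOn_pow_mul_exp_neg {c : ℝ} (hc : 0 < c) (j : ℕ) :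
    IntegrableOn (fun s : ℝ => s ^ j * Real.exp (-(c * s))) (Set.Ioi 0) := by
  -- A non-integrable function has Bochner integral 0, while the computed value is positive.
  by_contra h
  have h1 := integral_undef h
  rw [integral_pow_mul_exp_neg hc] at h1
  have : (0 : ℝ) < j.factorial / c ^ (j + 1) := by positivity
  linarith

lemma integrable_pow_mul_exp_neg_abs {c : ℝ} (hc : 0 < c) (j : ℕ) :
    Integrable (fun s : ℝ => |s| ^ j * Real.exp (-(c * |s|))) := by
  have h := integrableOn_pow_mul_exp_neg hc j
  have h' : IntegrableOn (fun s : ℝ => |s| ^ j * Real.exp (-(c * |s|))) (Set.Ioi 0) :=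
    h.congr_fun (fun s hs => by simp only [abs_of_pos (Set.mem_Ioi.1 hs)]) measurableSet_Ioi
  have h2 : IntegrableOn (fun s : ℝ => |s| ^ j * Real.exp (-(c * |s|))) (Set.Iic 0) := by
    rw [← Measure.map_neg_eq_self (volume : Measure ℝ)]
    have hm : MeasurableEmbedding fun x : ℝ => -x := (Homeomorph.neg ℝ).measurableEmbedding
    rw [hm.integrableOn_map_iff]
    simp_rw [Function.comp_def, abs_neg, Set.neg_preimage, Set.neg_Iic, neg_zero]
    exact Iff.mpr integrableOn_Ici_iff_integrableOn_Ioi h'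
  rw [← integrableOn_univ, ← Set.Iic_union_Ioi (a := (0 : ℝ))]
  exact h2.union h'

/-- A continuous function of at most linear growth is integrable against the density. -/
lemma integrable_mul_dens {z : ℝ} (hz : 0 < z) {k : ℝ → ℝ} (hk : Continuous k) {B C : ℝ}
    (hb : ∀ x, |k x| ≤ B + C * |x|) : Integrable (fun x => k x * dens z x) := by
  have h := (((integrable_pow_mul_exp_neg_abs hz 0).const_mul (|B| * Real.exp (z ^ 2 / 2))).add
    ((integrable_pow_mul_exp_neg_abs hz 1).const_mul (|C| * Real.exp (z ^ 2 / 2))))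
  refine h.mono' (hk.mul (continuous_dens z)).aestronglyMeasurable (ae_of_all _ fun x => ?_)
  simp only [Pi.add_apply, norm_mul, Real.norm_eq_abs, abs_of_pos (dens_pos z x), pow_zero, one_mul,
    pow_one]
  calc |k x| * dens z x ≤ (|B| + |C| * |x|) * (Real.exp (z ^ 2 / 2) * Real.exp (-(z * |x|))) := by
        gcongr
        · exact (dens_pos z x).le
        · refine (hb x).trans ?_
          gcongr <;> exact le_abs_self _
        · exact dens_le hz.le x
    _ = _ := by ring

lemma integrable_dens {z : ℝ} (hz : 0 < z) : Integrable (dens z) := by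
  simpa using integrable_mul_dens hz (k := fun _ => 1) continuous_const (B := 1) (C := 0)
    (by simp)

lemma integral_dens_pos {z : ℝ} (hz : 0 < z) : 0 < ∫ x, dens z x := by
  rw [integral_pos_iff_support_of_nonneg (fun x => (dens_pos z x).le) (integrable_dens hz)]
  have : Function.support (dens z) = Set.univ := by
    ext x; simp [(dens_pos z x).ne']
  rw [this]; simp

lemma tendsto_mul_dens_cocompact {z : ℝ} (hz : 0 < z) :
    Tendsto (fun x => x * dens z x) (cocompact ℝ) (𝓝 0) := by
  have h1 : Tendsto (fun y : ℝ => Real.exp (z ^ 2 / 2) * (y * Real.exp (-(z * y)))) atTop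
      (𝓝 0) := by
    have := (Real.tendsto_pow_mul_exp_neg_atTop_nhds_zero 1).comp
      (tendsto_id.const_mul_atTop hz)
    have h2 := this.const_mul (Real.exp (z ^ 2 / 2) / z)
    rw [mul_zero] at h2
    refine h2.congr fun y => ?_
    simp only [Function.comp, id, pow_one]
    field_simp
  refine squeeze_zero_norm (fun x => ?_) (h1.comp (tendsto_norm_cocompact_atTop (E := ℝ)))
  simp only [Function.comp, norm_mul, Real.norm_eq_abs, abs_of_pos (dens_pos z x)]
  calc |x| * dens z x ≤ |x| * (Real.exp (z ^ 2 / 2) * Real.exp (-(z * |x|))) := by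
        gcongr; exact dens_le hz.le x
    _ = _ := by ring

lemma abs_min_le {z : ℝ} (hz : 0 ≤ z) (x : ℝ) : |min x z| ≤ |x| := by
  rcases le_total x z with h | h
  · rw [min_eq_left h]
  · rw [min_eq_right h, abs_of_nonneg hz, abs_of_nonneg (hz.trans h)]; exact h

/-- Below z this uses |x| ≤ (1 + x²)/2, above z it uses x = (1/z)(zx). The right side has a
computable mean, since E[min(Y, z) Y] = 1. -/
lemma abs_le_mul_min {z : ℝ} (hz : 0 < z) (x : ℝ) :
    |x| ≤ 1 / 2 + (1 / 2 + 1 / z) * (min x z * x) := by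
  rcases le_total x z with h | h
  · rw [min_eq_left h]
    have : 0 ≤ 1 / z * (x * x) := by have := mul_self_nonneg x; positivity
    nlinarith [sq_nonneg (|x| - 1), sq_abs x]
  · rw [min_eq_right h, abs_of_nonneg (hz.le.trans h)]
    have : (1 / 2 + 1 / z) * (z * x) = z * x / 2 + x := by field_simp
    rw [this]; nlinarith

lemma integrable_min_mul_dens {z : ℝ} (hz : 0 < z) :
    Integrable (fun x => min x z * x * dens z x) := by
  have h : Integrable (fun x => |x| ^ 2 * Real.exp (-(z * |x|))) :=
    integrable_pow_mul_exp_neg_abs hz 2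
  refine (h.const_mul (Real.exp (z ^ 2 / 2))).mono'
    (((continuous_id.min continuous_const).mul continuous_id).mul
      (continuous_dens z)).aestronglyMeasurable (ae_of_all _ fun x => ?_)
  simp only [norm_mul, Real.norm_eq_abs, abs_of_pos (dens_pos z x)]
  calc |min x z| * |x| * dens z x
      ≤ |x| * |x| * (Real.exp (z ^ 2 / 2) * Real.exp (-(z * |x|))) :=
        mul_le_mul (mul_le_mul_of_nonneg_right (abs_min_le hz.le x) (abs_nonneg x))
          (dens_le hz.le x) (dens_pos z x).le (by positivity)
    _ = _ := by ring

/-- Integration by parts: the derivative of x times the density integrates to zero. -/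
lemma integral_min_mul_dens {z : ℝ} (hz : 0 < z) :
    ∫ x, min x z * x * dens z x = ∫ x, dens z x := by
  have hd : ∀ x, HasDerivAt (fun x => x * dens z x) (dens z x - min x z * x * dens z x) x := by
    intro x
    convert! (hasDerivAt_id x).mul (hasDerivAt_dens z x) using 1
    simp only [id]; ring
  have hi := integrable_dens hz
  have hi' := integrable_min_mul_dens hz
  have ht := tendsto_mul_dens_cocompact hz
  have := integral_of_hasDerivAt_of_tendsto hd (hi.sub hi') (ht.mono_left atBot_le_cocompact)
    (ht.mono_left atTop_le_cocompact)
  rw [integral_sub hi hi'] at this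
  linarith

lemma integral_abs_mul_dens_le {z : ℝ} (hz : 0 < z) :
    ∫ x, |x| * dens z x ≤ (1 + 1 / z) * ∫ x, dens z x := by
  have hi := integrable_dens hz
  have hi' := integrable_min_mul_dens hz
  calc ∫ x, |x| * dens z x
      ≤ ∫ x, ((1 / 2) * dens z x + (1 / 2 + 1 / z) * (min x z * x * dens z x)) := by
        refine integral_mono (integrable_mul_dens hz continuous_abs (B := 0) (C := 1) (by simp))
          ((hi.const_mul _).add (hi'.const_mul _)) fun x => ?_
        have := mul_le_mul_of_nonneg_right (abs_le_mul_min hz x) (dens_pos z x).le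
        dsimp only
        linarith
    _ = _ := by
        rw [integral_add (hi.const_mul _) (hi'.const_mul _), integral_const_mul,
          integral_const_mul, integral_min_mul_dens hz]
        ring

/-! ### A Laplace-type estimate for tail integrals. -/

/-- Here q is a density ratio seen from a point at distance x from 0, and the integral is the Stein
solution there up to sign. The second bound controls x g', in which the leading term k0 cancels
because x ∫ exp(-xs) ds = 1. -/
lemma laplace_tail_bounds {x A k0 : ℝ} (hx : 0 < x) (hA : 0 ≤ A) {k q : ℝ → ℝ} (hk : Continuous k)
    (hq : Continuous q) (hq1 : ∀ s, 0 < s → Real.exp (-(x * s) - s ^ 2 / 2) ≤ q s)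
    (hq2 : ∀ s, 0 < s → q s ≤ Real.exp (-(x * s))) (hkk : ∀ s, 0 < s → |k s - k0| ≤ s)
    (hk0 : |k0| ≤ x + A) :
    |∫ s in Set.Ioi (0 : ℝ), k s * q s| ≤ (x + A) / x + 1 / x ^ 2 ∧
      x * |k0 - x * ∫ s in Set.Ioi (0 : ℝ), k s * q s| ≤ 2 + A := by
  have i0 : IntegrableOn (fun s : ℝ => Real.exp (-(x * s))) (Set.Ioi 0) := by
    simpa using integrableOn_pow_mul_exp_neg hx 0
  have i1 : IntegrableOn (fun s : ℝ => s * Real.exp (-(x * s))) (Set.Ioi 0) := by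
    simpa using integrableOn_pow_mul_exp_neg hx 1
  have i2 := integrableOn_pow_mul_exp_neg hx 2
  have v0 : ∫ s in Set.Ioi (0 : ℝ), Real.exp (-(x * s)) = 1 / x := by
    simpa using integral_pow_mul_exp_neg hx 0
  have v1 : ∫ s in Set.Ioi (0 : ℝ), s * Real.exp (-(x * s)) = 1 / x ^ 2 := by
    simpa using integral_pow_mul_exp_neg hx 1
  have v2 : ∫ s in Set.Ioi (0 : ℝ), s ^ 2 * Real.exp (-(x * s)) = 2 / x ^ 3 := by
    simpa using integral_pow_mul_exp_neg hx 2
  have hq0 : ∀ s, 0 < s → 0 ≤ q s := fun s hs => (Real.exp_pos _).le.trans (hq1 s hs)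
  have hks : ∀ s, 0 < s → |k s| ≤ |k0| + s := fun s hs => by
    have := abs_add_le (k s - k0) k0
    rw [sub_add_cancel] at this
    linarith [hkk s hs]
  have hb : ∀ᵐ s ∂(volume.restrict (Set.Ioi (0 : ℝ))), ‖k s * q s‖ ≤
      |k0| * Real.exp (-(x * s)) + s * Real.exp (-(x * s)) := by
    refine (ae_restrict_iff' measurableSet_Ioi).2 (ae_of_all _ fun s hs => ?_)
    rw [norm_mul, Real.norm_eq_abs, Real.norm_eq_abs, abs_of_nonneg (hq0 s hs), ← add_mul]
    exact mul_le_mul (hks s hs) (hq2 s hs) (hq0 s hs) (add_nonneg (abs_nonneg _) (le_of_lt hs))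
  have ikq : IntegrableOn (fun s => k s * q s) (Set.Ioi 0) :=
    Integrable.mono' ((i0.const_mul _).add i1) (hk.mul hq).aestronglyMeasurable hb
  constructor
  · have := norm_integral_le_of_norm_le ((i0.const_mul |k0|).add i1) hb
    simp only [Pi.add_apply] at this
    rw [integral_add (i0.const_mul _) i1, integral_const_mul, v0, v1, Real.norm_eq_abs] at this
    refine this.trans ?_
    rw [mul_one_div]
    gcongr
  · set I := ∫ s in Set.Ioi (0 : ℝ), k s * q s with hI
    have hrep : k0 - x * I = ∫ s in Set.Ioi (0 : ℝ),
        (x * k0 * Real.exp (-(x * s)) - x * (k s * q s)) := by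
      rw [integral_sub (i0.const_mul _) (ikq.const_mul _), integral_const_mul, integral_const_mul,
        v0, ← hI]
      field_simp
    -- The bound D is left free: exp(-xs) is the right choice for small x, and (s²/2) exp(-xs) for
    -- large x.
    have key : ∀ s, 0 < s → ∀ D, Real.exp (-(x * s)) - q s ≤ D →
        ‖x * k0 * Real.exp (-(x * s)) - x * (k s * q s)‖ ≤
          x * (|k0| * D + s * Real.exp (-(x * s))) := by
      intro s hs D hD
      have e : x * k0 * Real.exp (-(x * s)) - x * (k s * q s)
          = x * (k0 * (Real.exp (-(x * s)) - q s) - (k s - k0) * q s) := by ring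
      rw [e, norm_mul, Real.norm_eq_abs, Real.norm_eq_abs, abs_of_pos hx]
      refine mul_le_mul_of_nonneg_left ((abs_sub _ _).trans ?_) hx.le
      rw [abs_mul, abs_mul, abs_of_nonneg (hq0 s hs), abs_of_nonneg (sub_nonneg.2 (hq2 s hs))]
      exact add_le_add (mul_le_mul_of_nonneg_left hD (abs_nonneg _))
        (mul_le_mul (hkk s hs) (hq2 s hs) (hq0 s hs) hs.le)
    have b1 : |k0 - x * I| ≤ x * (|k0| * (1 / x) + 1 / x ^ 2) := by
      rw [hrep, ← Real.norm_eq_abs]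
      have := norm_integral_le_of_norm_le (((i0.const_mul |k0|).add i1).const_mul x)
        ((ae_restrict_iff' measurableSet_Ioi).2 (ae_of_all _ fun s hs =>
          key s hs (Real.exp (-(x * s))) (by linarith [hq0 s hs])))
      refine this.trans_eq ?_
      simp only [Pi.add_apply]
      rw [integral_const_mul, integral_add (i0.const_mul _) i1, integral_const_mul, v0, v1]
    have b2 : |k0 - x * I| ≤ x * (|k0| * (1 / x ^ 3) + 1 / x ^ 2) := by
      rw [hrep, ← Real.norm_eq_abs]
      have := norm_integral_le_of_norm_le
        ((((i2.const_mul (1 / 2)).const_mul |k0|).add i1).const_mul x)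
        ((ae_restrict_iff' measurableSet_Ioi).2 (ae_of_all _ fun s hs =>
          key s hs (1 / 2 * (s ^ 2 * Real.exp (-(x * s)))) (by
            have h1 := hq1 s hs
            rw [sub_eq_add_neg, Real.exp_add] at h1
            have h2 := Real.add_one_le_exp (-(s ^ 2 / 2))
            have h3 := mul_le_mul_of_nonneg_left h2 (Real.exp_pos (-(x * s))).le
            linarith)))
      refine this.trans_eq ?_
      simp only [Pi.add_apply]
      rw [integral_const_mul, integral_add ((i2.const_mul _).const_mul _) i1, integral_const_mul,
        integral_const_mul, v1, v2]
      ring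
    rcases le_total x 1 with h1 | h1
    · calc x * |k0 - x * I| ≤ x * (x * (|k0| * (1 / x) + 1 / x ^ 2)) := by gcongr
        _ = x * |k0| + 1 := by field_simp
        _ ≤ 1 * (1 + A) + 1 := by
          have : |k0| ≤ 1 + A := by linarith
          gcongr
        _ = 2 + A := by ring
    · calc x * |k0 - x * I| ≤ x * (x * (|k0| * (1 / x ^ 3) + 1 / x ^ 2)) := by gcongr
        _ = |k0| / x + 1 := by field_simp
        _ ≤ (x + A) / x + 1 := by gcongr
        _ = 1 + A / x + 1 := by field_simp
        _ ≤ 1 + A + 1 := by gcongr; exact div_le_self hA h1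
        _ = 2 + A := by ring

/-! ### The Stein equation and its solution. -/

/-- The solution of the Stein equation `g' = min x z * g + k` for the density `dens z`. -/
def steinSol (z : ℝ) (k : ℝ → ℝ) (x : ℝ) : ℝ := (∫ y in Set.Iic x, k y * dens z y) / dens z x

lemma hasDerivAt_steinSol {z : ℝ} {k : ℝ → ℝ} (hk : Continuous k)
    (hi : Integrable (fun x => k x * dens z x)) (x : ℝ) :
    HasDerivAt (steinSol z k) (min x z * steinSol z k x + k x) x := by
  have hc : Continuous fun x => k x * dens z x := hk.mul (continuous_dens z)
  have e : (fun x => ∫ y in Set.Iic x, k y * dens z y) =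
      fun x => (∫ y in (0 : ℝ)..x, k y * dens z y) + ∫ y in Set.Iic 0, k y * dens z y := by
    funext x
    rw [← intervalIntegral.integral_Iic_sub_Iic hi.integrableOn hi.integrableOn]
    ring
  have h1 : HasDerivAt (fun x => ∫ y in Set.Iic x, k y * dens z y) (k x * dens z x) x := by
    rw [e]
    exact (intervalIntegral.integral_hasDerivAt_right (hc.intervalIntegrable _ _)
      (hc.stronglyMeasurableAtFilter _ _) hc.continuousAt).add_const _
  convert! h1.div (hasDerivAt_dens z x) (dens_pos z x).ne' using 1
  have := (dens_pos z x).ne'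
  unfold steinSol
  field_simp
  ring

lemma steinSol_eq_left {z : ℝ} {k : ℝ → ℝ} (x : ℝ) :
    steinSol z k x = ∫ s in Set.Ioi (0 : ℝ), k (x - s) * (dens z (x - s) / dens z x) := by
  have h := (Measure.measurePreserving_sub_left (volume : Measure ℝ) x).setIntegral_preimage_emb
    (MeasurableEquiv.subLeft x).measurableEmbedding (fun y => k y * dens z y) (Set.Iic x)
  have hp : (fun s : ℝ => x - s) ⁻¹' Set.Iic x = Set.Ici 0 := by ext s; simp
  rw [hp, integral_Ici_eq_integral_Ioi] at h
  unfold steinSol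
  rw [← h, ← integral_div]
  simp only [mul_div_assoc]

/-- Centring of k lets the left tail be exchanged for the right one, which is the one that decays
relative to `dens z x` when x > 0. -/
lemma steinSol_eq_right {z : ℝ} {k : ℝ → ℝ} (hi : Integrable (fun x => k x * dens z x))
    (h0 : ∫ x, k x * dens z x = 0) (x : ℝ) :
    steinSol z k x = -∫ s in Set.Ioi (0 : ℝ), k (x + s) * (dens z (x + s) / dens z x) := by
  have h := (measurePreserving_add_left (volume : Measure ℝ) x).setIntegral_preimage_emb
    (MeasurableEquiv.addLeft x).measurableEmbedding (fun y => k y * dens z y) (Set.Ioi x)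
  have hp : (fun s : ℝ => x + s) ⁻¹' Set.Ioi x = Set.Ioi 0 := by ext s; simp
  rw [hp] at h
  have h2 := intervalIntegral.integral_Iic_add_Ioi (b := x) hi.integrableOn hi.integrableOn
  rw [h0] at h2
  unfold steinSol
  rw [eq_neg_of_add_eq_zero_left h2, ← h, neg_div, ← integral_div]
  simp only [mul_div_assoc]

lemma dens_div (z x y : ℝ) : dens z y / dens z x = Real.exp (potential z x - potential z y) := by
  unfold dens
  rw [← Real.exp_sub]; congr 1; ring

/-! ### Bounds on the Stein solution. -/

section bounds

variable {z A : ℝ} {k : ℝ → ℝ}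

lemma abs_sub_le_of_lipschitz (hk : LipschitzWith 1 k) (x y : ℝ) : |k x - k y| ≤ |x - y| := by
  simpa [Real.dist_eq] using hk.dist_le_mul x y

lemma integrable_mul_dens_of_le (hz : 0 < z) (hk : LipschitzWith 1 k)
    (hb : ∀ x, |k x| ≤ |x| + A) : Integrable (fun x => k x * dens z x) :=
  integrable_mul_dens hz hk.continuous (B := A) (C := 1) fun x => by linarith [hb x]

/-- Apply the Laplace estimate on the tail pointing away from 0. For x < 0 the density ratio is
exactly Gaussian; for 0 < x ≤ z the drift min(y, z) lies between x and y beyond x, which traps the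
ratio as required. -/
lemma steinSol_bounds_ne_zero (hz : 0 < z) (hA : 0 ≤ A) (hk : LipschitzWith 1 k)
    (hb : ∀ x, |k x| ≤ |x| + A) (h0 : ∫ x, k x * dens z x = 0) {x : ℝ} (hx : x ≠ 0) (hxz : x ≤ z) :
    |steinSol z k x| ≤ (|x| + A) / |x| + 1 / |x| ^ 2 ∧
      |x| * |x * steinSol z k x + k x| ≤ 2 + A := by
  rcases lt_or_gt_of_ne hx with h | h
  · have hq : ∀ s, 0 < s →
        dens z (x - s) / dens z x = Real.exp (-((-x) * s) - s ^ 2 / 2) := fun s hs => by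
      rw [dens_div, potential_of_le hxz, potential_of_le (by linarith)]
      congr 1; ring
    have := laplace_tail_bounds (x := -x) (A := A) (k0 := k x) (k := fun s => k (x - s))
      (q := fun s => dens z (x - s) / dens z x) (by linarith) hA
      (hk.continuous.comp (continuous_const.sub continuous_id))
      (((continuous_dens z).comp (continuous_const.sub continuous_id)).div_const _)
      (fun s hs => (hq s hs).ge) (fun s hs => (hq s hs).trans_le (Real.exp_le_exp.2 (by nlinarith)))
      (fun s hs => (abs_sub_le_of_lipschitz hk _ _).trans_eq (by simp [abs_of_pos hs]))
      ((hb x).trans_eq (by rw [abs_of_neg h]))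
    rw [← steinSol_eq_left] at this
    rw [abs_of_neg h]
    refine ⟨this.1, ?_⟩
    convert this.2 using 3
    ring
  · have := laplace_tail_bounds (x := x) (A := A) (k0 := k x) (k := fun s => k (x + s))
      (q := fun s => dens z (x + s) / dens z x) h hA
      (hk.continuous.comp (continuous_const.add continuous_id))
      (((continuous_dens z).comp (continuous_const.add continuous_id)).div_const _)
      (fun s hs => by
        rw [dens_div, Real.exp_le_exp, potential_of_le hxz]
        unfold potential
        nlinarith [sq_nonneg (max (x + s - z) 0)])
      (fun s hs => by
        rw [dens_div, Real.exp_le_exp, potential_of_le hxz]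
        rcases le_total (x + s) z with h' | h'
        · rw [potential_of_le h']; nlinarith
        · rw [potential_of_ge h']
          nlinarith [mul_nonneg (sub_nonneg.2 hxz) (sub_nonneg.2 h'), sq_nonneg (z - x)])
      (fun s hs => (abs_sub_le_of_lipschitz hk _ _).trans_eq (by simp [abs_of_pos hs]))
      ((hb x).trans_eq (by rw [abs_of_pos h]))
    rw [← neg_eq_iff_eq_neg.2 (steinSol_eq_right (integrable_mul_dens_of_le hz hk hb) h0 x)]
      at this
    rw [abs_of_pos h]
    refine ⟨by simpa using this.1, ?_⟩
    convert this.2 using 3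
    ring

lemma abs_mul_deriv_steinSol_le (hz : 0 < z) (hA : 0 ≤ A) (hk : LipschitzWith 1 k)
    (hb : ∀ x, |k x| ≤ |x| + A) (h0 : ∫ x, k x * dens z x = 0) {x : ℝ} (hxz : x ≤ z) :
    |x| * |x * steinSol z k x + k x| ≤ 2 + A := by
  rcases eq_or_ne x 0 with rfl | hx
  · simp; linarith
  · exact (steinSol_bounds_ne_zero hz hA hk hb h0 hx hxz).2

lemma abs_steinSol_le_of_one_le (hz : 0 < z) (hA : 0 ≤ A) (hk : LipschitzWith 1 k)
    (hb : ∀ x, |k x| ≤ |x| + A) (h0 : ∫ x, k x * dens z x = 0) {x : ℝ} (hx : 1 ≤ |x|)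
    (hxz : x ≤ z) : |steinSol z k x| ≤ 2 + A := by
  have hx0 : x ≠ 0 := by rintro rfl; simp at hx; linarith
  have hp : 0 < |x| := by linarith
  refine (steinSol_bounds_ne_zero hz hA hk hb h0 hx0 hxz).1.trans ?_
  rw [add_div, div_self hp.ne']
  have h1 : A / |x| ≤ A := div_le_self hA hx
  have h2 : 1 / |x| ^ 2 ≤ 1 := div_le_self zero_le_one (by nlinarith)
  linarith

lemma abs_steinSol_le (hz : 0 < z) (hA : 0 ≤ A) (hk : LipschitzWith 1 k)
    (hb : ∀ x, |k x| ≤ |x| + A) (h0 : ∫ x, k x * dens z x = 0) {x : ℝ}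
    (hxz : x ≤ z) : |steinSol z k x| ≤ 7 + 5 * A := by
  rcases le_total 1 |x| with hx | hx
  · linarith [abs_steinSol_le_of_one_le hz hA hk hb h0 hx hxz]
  · have hi := integrable_mul_dens_of_le hz hk hb
    have h1 := abs_steinSol_le_of_one_le hz hA hk hb h0 (x := -1) (by simp) (by linarith)
    rw [abs_le] at hx
    have hle1 : ∀ y, y ≤ z → dens z y ≤ 1 := fun y hy => by
      unfold dens
      rw [potential_of_le hy, Real.exp_le_one_iff]
      nlinarith [sq_nonneg y]
    have e : (∫ y in Set.Iic x, k y * dens z y) =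
        (∫ y in Set.Iic (-1), k y * dens z y) + ∫ y in (-1 : ℝ)..x, k y * dens z y := by
      rw [← intervalIntegral.integral_Iic_sub_Iic hi.integrableOn hi.integrableOn]
      ring
    have b1 : |∫ y in (-1 : ℝ)..x, k y * dens z y| ≤ (1 + A) * |x - (-1)| := by
      rw [← Real.norm_eq_abs]
      refine intervalIntegral.norm_integral_le_of_norm_le_const fun y hy => ?_
      rw [Set.uIoc_of_le hx.1] at hy
      rw [norm_mul, Real.norm_eq_abs, Real.norm_eq_abs, abs_of_pos (dens_pos z y)]
      have hy1 : |y| ≤ 1 := abs_le.2 ⟨hy.1.le, hy.2.trans hx.2⟩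
      calc |k y| * dens z y ≤ (1 + A) * 1 := by
            refine mul_le_mul ((hb y).trans (by linarith)) (hle1 y (hy.2.trans hxz))
              (dens_pos z y).le (by linarith)
        _ = 1 + A := mul_one _
    have b2 : |∫ y in Set.Iic (-1), k y * dens z y| ≤ 2 + A := by
      unfold steinSol at h1
      rw [abs_div, abs_of_pos (dens_pos _ _), div_le_iff₀ (dens_pos _ _)] at h1
      refine h1.trans ?_
      have := hle1 (-1) (by linarith)
      nlinarith
    -- For |x| ≤ 1 the numerator is at most (2 + A) + 2(1 + A) = 4 + 3A. The density is at least
    -- exp(-1/2) ≥ 20/33, and (33/20)(4 + 3A) ≤ 7 + 5A.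
    have b3 : 1 ≤ dens z x * (33 / 20) := by
      have : Real.exp (-(1 / 2)) ≤ dens z x := by
        unfold dens
        rw [potential_of_le hxz, Real.exp_le_exp]
        nlinarith
      have h4 : (1 : ℝ) ≤ Real.exp (-(1 / 2)) * (33 / 20) := by
        have h5 : Real.exp (1 / 2) ≤ 33 / 20 := by
          have h6 : Real.exp (1 / 2) ^ 2 = Real.exp 1 := by
            rw [← Real.exp_nat_mul]; norm_num
          have := Real.exp_one_lt_d9
          nlinarith [Real.exp_pos (1 / 2)]
        rw [Real.exp_neg, inv_mul_eq_div, le_div_iff₀ (Real.exp_pos _)]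
        linarith
      nlinarith
    unfold steinSol
    rw [abs_div, abs_of_pos (dens_pos _ _), div_le_iff₀ (dens_pos _ _), e]
    refine (abs_add_le _ _).trans ?_
    have b4 : |x - (-1)| ≤ 2 := abs_le.2 ⟨by linarith, by linarith⟩
    have b5 : (1 + A) * |x - (-1)| ≤ (1 + A) * 2 := by gcongr
    have b6 : (4 + 3 * A) * 1 ≤ (4 + 3 * A) * (dens z x * (33 / 20)) := by gcongr
    nlinarith [dens_pos z x]

/-- Beyond z the density ratio is exp(-zs) whatever the base point, so g is an exponential average
of translates of k and inherits its Lipschitz constant times 1/z. -/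
lemma abs_steinSol_sub_le (hz : 0 < z) (hk : LipschitzWith 1 k)
    (hb : ∀ x, |k x| ≤ |x| + A) (h0 : ∫ x, k x * dens z x = 0) {x y : ℝ}
    (hx : z ≤ x) (hy : z ≤ y) : |steinSol z k x - steinSol z k y| ≤ |x - y| / z := by
  have hi := integrable_mul_dens_of_le hz hk hb
  have hr : ∀ x, z ≤ x → steinSol z k x =
      -∫ s in Set.Ioi (0 : ℝ), k (x + s) * Real.exp (-(z * s)) := by
    intro x hx
    rw [steinSol_eq_right hi h0]
    congr 1
    refine setIntegral_congr_fun measurableSet_Ioi fun s hs => ?_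
    rw [dens_div, potential_of_ge hx, potential_of_ge (hx.trans (by linarith [Set.mem_Ioi.1 hs]))]
    congr 2; ring
  have i0 : IntegrableOn (fun s : ℝ => Real.exp (-(z * s))) (Set.Ioi 0) := by
    simpa using integrableOn_pow_mul_exp_neg hz 0
  have i1 : IntegrableOn (fun s : ℝ => s * Real.exp (-(z * s))) (Set.Ioi 0) := by
    simpa using integrableOn_pow_mul_exp_neg hz 1
  have v0 : ∫ s in Set.Ioi (0 : ℝ), Real.exp (-(z * s)) = 1 / z := by
    simpa using integral_pow_mul_exp_neg hz 0
  have ii : ∀ x, IntegrableOn (fun s => k (x + s) * Real.exp (-(z * s))) (Set.Ioi 0) := fun x => by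
    refine Integrable.mono' ((i0.const_mul (|x| + A)).add i1) (Continuous.aestronglyMeasurable
      ((hk.continuous.comp (continuous_const.add continuous_id)).mul
        (Real.continuous_exp.comp (continuous_const.mul continuous_id).neg)))
      ((ae_restrict_iff' measurableSet_Ioi).2 (ae_of_all _ fun s hs => ?_))
    rw [norm_mul, Real.norm_eq_abs, Real.norm_eq_abs, Real.abs_exp, Pi.add_apply, ← add_mul]
    gcongr
    have h1 := hb (x + s)
    have h2 := abs_add_le x s
    rw [abs_of_pos (Set.mem_Ioi.1 hs)] at h2
    linarith
  rw [hr x hx, hr y hy, neg_sub_neg, ← integral_sub (ii y) (ii x)]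
  have := norm_integral_le_of_norm_le (i0.const_mul |x - y|)
    (f := fun s => k (y + s) * Real.exp (-(z * s)) - k (x + s) * Real.exp (-(z * s)))
    ((ae_restrict_iff' measurableSet_Ioi).2 (ae_of_all _ fun s _ => by
      rw [← sub_mul, norm_mul, Real.norm_eq_abs, Real.norm_eq_abs, Real.abs_exp]
      refine mul_le_mul_of_nonneg_right ((abs_sub_le_of_lipschitz hk _ _).trans_eq ?_)
        (Real.exp_pos _).le
      rw [abs_sub_comm]; congr 1; ring))
  rwa [integral_const_mul, v0, mul_one_div] at this

/-- The Stein equation can be solved by a function of linear growth whose finite differences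
satisfy the equation up to an error of the order of the step size. -/
theorem exists_discrete_stein_solution (hz : 0 < z) (hA : 0 ≤ A) (hk : LipschitzWith 1 k)
    (hb : ∀ x, |k x| ≤ |x| + A) (h0 : ∫ x, k x * dens z x = 0) :
    ∃ g : ℝ → ℝ, (∃ B, ∀ x, |g x| ≤ B + |x| / z) ∧ ∀ δ > 0, ∀ x,
      (x + δ ≤ z → |(g (x + δ) - g x) / δ - min x z * g x - k x| ≤ (10 + 6 * A) * δ) ∧
      (z ≤ x → |(g (x + δ) - g x) / δ - min x z * g x - k x| ≤ 2 * δ) := by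
  have hi := integrable_mul_dens_of_le hz hk hb
  have hd := hasDerivAt_steinSol hk.continuous hi
  refine ⟨steinSol z k, ⟨7 + 5 * A, fun x => ?_⟩, fun δ hδ x => ?_⟩
  · rcases le_total x z with h | h
    · have : 0 ≤ |x| / z := by positivity
      linarith [abs_steinSol_le hz hA hk hb h0 h]
    · have h1 := abs_steinSol_sub_le hz hk hb h0 h le_rfl
      have h2 := abs_steinSol_le hz hA hk hb h0 (le_refl z)
      have h3 : |x - z| / z ≤ |x| / z := by
        refine div_le_div_of_nonneg_right ?_ hz.le
        rw [abs_of_nonneg (by linarith), abs_of_nonneg (by linarith)]; linarith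
      have h4 := abs_sub_abs_le_abs_sub (steinSol z k x) (steinSol z k z)
      linarith
  · obtain ⟨c, hc, hc'⟩ := exists_hasDerivAt_eq_slope (steinSol z k) _ (lt_add_of_pos_right x hδ)
      (continuous_iff_continuousAt.2 fun y => (hd y).continuousAt).continuousOn
      (fun y _ => hd y)
    rw [add_sub_cancel_left] at hc'
    rw [← hc']
    have hcx : |c - x| ≤ δ := abs_le.2 ⟨by linarith [hc.1], by linarith [hc.2]⟩
    have hkc := abs_sub_le_of_lipschitz hk c x
    constructor
    · intro hxz
      -- The derivative of x g is g + x g', bounded by (7 + 5A) + (2 + A).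
      have hmv : |c * steinSol z k c - x * steinSol z k x| ≤ (9 + 6 * A) * |c - x| := by
        refine Convex.norm_image_sub_le_of_norm_hasDerivWithin_le
          (f := fun x => x * steinSol z k x) (s := Set.Iic z)
          (f' := fun x => 1 * steinSol z k x + x * (min x z * steinSol z k x + k x))
          (fun y _ => ((hasDerivAt_id y).mul (hd y)).hasDerivWithinAt) (fun y hy => ?_)
          (convex_Iic z) (by rw [Set.mem_Iic]; linarith) (by rw [Set.mem_Iic]; linarith [hc.2])
        have h1 := abs_steinSol_le hz hA hk hb h0 hy
        have h2 := abs_mul_deriv_steinSol_le hz hA hk hb h0 hy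
        rw [min_eq_left hy, one_mul, Real.norm_eq_abs]
        refine (abs_add_le _ _).trans ?_
        rw [abs_mul y]
        linarith
      rw [min_eq_left (by linarith [hc.2] : c ≤ z), min_eq_left (by linarith : x ≤ z)]
      have e : c * steinSol z k c + k c - x * steinSol z k x - k x
          = (c * steinSol z k c - x * steinSol z k x) + (k c - k x) := by ring
      rw [e]
      refine (abs_add_le _ _).trans ?_
      have : (10 + 6 * A) * |c - x| ≤ (10 + 6 * A) * δ := by gcongr
      linarith
    · intro hzx
      have h1 := abs_steinSol_sub_le hz hk hb h0 (hzx.trans hc.1.le) hzx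
      rw [min_eq_right (hzx.trans hc.1.le), min_eq_right hzx]
      have e : z * steinSol z k c + k c - z * steinSol z k x - k x
          = z * (steinSol z k c - steinSol z k x) + (k c - k x) := by ring
      rw [e]
      refine (abs_add_le _ _).trans ?_
      rw [abs_mul, abs_of_pos hz]
      rw [le_div_iff₀' hz] at h1
      linarith

end bounds

/-! ### The discrete Stein identity and the error bound. -/

section discrete

variable {n : ℕ} {R : ℝ} {a : ℕ → ℝ}

lemma summable_of_balance (hR : 0 ≤ R) (hRn : R < n) (ha : ∀ k, 0 ≤ a k)
    (hbal : ∀ k, R * a k = (min (k + 1) n : ℕ) * a (k + 1)) :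
    Summable fun k : ℕ => ((k : ℝ) + 1) * a k := by
  have hn : (0 : ℝ) < n := hR.trans_lt hRn
  -- The midpoint of R/n and 1: past n the ratio of successive terms is R/n, and the slack absorbs
  -- the factor (k + 2)/(k + 1).
  set r : ℝ := (R + n) / (2 * n) with hr
  have hr1 : r < 1 := by rw [hr, div_lt_one (by positivity)]; linarith
  obtain ⟨K, hK⟩ := exists_nat_gt (R / ((n - R) / 2))
  refine summable_of_ratio_norm_eventually_le hr1 ?_
  filter_upwards [eventually_ge_atTop K, eventually_ge_atTop n] with k hk hkn
  have hb := hbal k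
  rw [min_eq_right (by omega)] at hb
  have h1 : a (k + 1) = R * a k / n := by rw [hb]; field_simp
  rw [Real.norm_of_nonneg (mul_nonneg (by positivity) (ha _)),
    Real.norm_of_nonneg (mul_nonneg (by positivity) (ha _)), h1, hr]
  rw [div_lt_iff₀ (by linarith)] at hK
  have hk' : (K : ℝ) ≤ k := by exact_mod_cast hk
  have h2 : R * (k + 2) ≤ (R + n) / 2 * (k + 1) := by nlinarith
  have h3 := mul_le_mul_of_nonneg_right h2 (ha k)
  push_cast
  rw [← sub_nonneg]
  have : (R + n) / (2 * n) * ((k + 1) * a k) - (k + 1 + 1) * (R * a k / n)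
      = ((R + n) / 2 * (k + 1) * a k - R * (k + 2) * a k) / n := by field_simp; ring
  rw [this]
  exact div_nonneg (by linarith) hn.le

lemma summable_mul_of_le (hR : 0 ≤ R) (hRn : R < n) (ha : ∀ k, 0 ≤ a k)
    (hbal : ∀ k, R * a k = (min (k + 1) n : ℕ) * a (k + 1)) {u : ℕ → ℝ} {B : ℝ}
    (hu : ∀ k : ℕ, |u k| ≤ B * (k + 1)) : Summable fun k => a k * u k := by
  refine Summable.of_norm_bounded ((summable_of_balance hR hRn ha hbal).mul_left B) fun k => ?_
  rw [norm_mul, Real.norm_eq_abs, Real.norm_eq_abs, abs_of_nonneg (ha k)]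
  have := mul_le_mul_of_nonneg_left (hu k) (ha k)
  linarith

lemma tsum_generator_eq_zero (hR : 0 ≤ R) (hRn : R < n) (ha : ∀ k, 0 ≤ a k)
    (hbal : ∀ k, R * a k = (min (k + 1) n : ℕ) * a (k + 1)) {u : ℕ → ℝ} {B : ℝ}
    (hu : ∀ k : ℕ, |u k| ≤ B * (k + 1)) :
    Summable (fun k => a k * (R * u (k + 1) - (min k n : ℕ) * u k)) ∧
    ∑' k, a k * (R * u (k + 1) - (min k n : ℕ) * u k) = 0 := by
  have hB : 0 ≤ B := by simpa using (abs_nonneg _).trans (hu 0)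
  have s1 : Summable fun k => a k * (R * u (k + 1)) := by
    refine summable_mul_of_le (B := 2 * R * B) hR hRn ha hbal fun k => ?_
    rw [abs_mul, abs_of_nonneg hR]
    have h := hu (k + 1)
    push_cast at h
    have h' : |u (k + 1)| ≤ 2 * B * (k + 1) := by
      have : 0 ≤ B * (k : ℝ) := by positivity
      linarith
    have := mul_le_mul_of_nonneg_left h' hR
    linarith
  have s2 : Summable fun k => a k * ((min k n : ℕ) * u k) := by
    refine summable_mul_of_le (B := n * B) hR hRn ha hbal fun k => ?_
    rw [abs_mul, Nat.abs_cast, mul_assoc]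
    have : ((min k n : ℕ) : ℝ) ≤ n := by exact_mod_cast min_le_right k n
    exact mul_le_mul this (hu k) (abs_nonneg _) (by positivity)
  have e : ∑' k, a k * (R * u (k + 1)) = ∑' k, a k * ((min k n : ℕ) * u k) := by
    -- The k = 0 term vanishes because `min 0 n = 0`; after the shift, balance matches the two sums
    -- termwise.
    rw [s2.tsum_eq_zero_add]
    simp only [zero_le, min_eq_left, Nat.cast_zero, zero_mul, mul_zero, zero_add]
    refine tsum_congr fun k => ?_
    rw [← mul_assoc, mul_comm (a k), hbal k]
    ring
  simp_rw [mul_sub]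
  exact ⟨s1.sub s2, by rw [s1.tsum_sub s2, e, sub_self]⟩

/-- The scaled state `(k - R) δ`. -/
def grid (R δ : ℝ) (k : ℕ) : ℝ := (k - R) * δ

variable {δ z : ℝ}

lemma min_grid (hδ : 0 < δ) (hz : z = (n - R) * δ) (k : ℕ) :
    min (grid R δ k) z = ((min k n : ℕ) - R) * δ := by
  subst hz
  unfold grid
  rcases le_total k n with h | h
  · have : (k : ℝ) ≤ n := by exact_mod_cast h
    rw [min_eq_left h, min_eq_left (by nlinarith)]
  · have : (n : ℝ) ≤ k := by exact_mod_cast h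
    rw [min_eq_right h, min_eq_right (by nlinarith)]

lemma grid_succ (k : ℕ) : grid R δ (k + 1) = grid R δ k + δ := by
  unfold grid; push_cast; ring

lemma exists_abs_grid_le (hR : 0 ≤ R) (hδ : 0 < δ) {f : ℝ → ℝ} {B C : ℝ} (hC : 0 ≤ C)
    (hf : ∀ x, |f x| ≤ B + C * |x|) :
    ∃ D, ∀ k : ℕ, |f (grid R δ k)| ≤ D * (k + 1) := by
  refine ⟨|B| + C * ((1 + R) * δ), fun k => (hf _).trans ?_⟩
  have h1 : |grid R δ k| ≤ (k + R) * δ := by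
    unfold grid
    rw [abs_mul, abs_of_pos hδ]
    refine mul_le_mul_of_nonneg_right (abs_le.2 ⟨?_, ?_⟩) hδ.le <;>
      linarith [(Nat.cast_nonneg k : (0 : ℝ) ≤ k)]
  have hk : (0 : ℝ) ≤ k := Nat.cast_nonneg k
  have h2 : (k + R) * δ ≤ ((1 + R) * δ) * (k + 1) := by
    have : 0 ≤ R * δ * k := by positivity
    nlinarith
  have h3 : C * |grid R δ k| ≤ C * (((1 + R) * δ) * (k + 1)) := by gcongr; exact h1.trans h2
  have h4 : 0 ≤ |B| * k := by positivity
  nlinarith [le_abs_self B]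

/-- The stationary expectation of a finite-difference Stein operator vanishes. -/
lemma tsum_stein_eq_zero (hR : 0 < R) (hRn : R < n) (ha : ∀ k, 0 ≤ a k)
    (hbal : ∀ k, R * a k = (min (k + 1) n : ℕ) * a (k + 1)) (hδ : 0 < δ) (hδR : R * δ ^ 2 = 1)
    (hz : z = (n - R) * δ) {g : ℝ → ℝ} {B C : ℝ} (hC : 0 ≤ C) (hg : ∀ x, |g x| ≤ B + C * |x|) :
    Summable (fun k => a k * ((g (grid R δ k + δ) - g (grid R δ k)) / δ
      - min (grid R δ k) z * g (grid R δ k))) ∧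
    ∑' k, a k * ((g (grid R δ k + δ) - g (grid R δ k)) / δ
      - min (grid R δ k) z * g (grid R δ k)) = 0 := by
  obtain ⟨D, hD⟩ := exists_abs_grid_le hR.le hδ hC hg
  obtain ⟨hs, ht⟩ := tsum_generator_eq_zero hR.le hRn ha hbal hD
  have e : ∀ k, a k * ((g (grid R δ k + δ) - g (grid R δ k)) / δ
      - min (grid R δ k) z * g (grid R δ k)) =
      δ * (a k * (R * g (grid R δ (k + 1)) - (min k n : ℕ) * g (grid R δ k))) := by
    intro k
    rw [min_grid hδ hz, grid_succ]
    have : 1 / δ = R * δ := by rw [← hδR]; field_simp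
    rw [div_eq_mul_one_div, this]
    ring
  simp_rw [e]
  exact ⟨hs.mul_left δ, by rw [tsum_mul_left, ht, mul_zero]⟩

lemma grid_add_le (hδ : 0 < δ) (hz : z = (n - R) * δ) {k : ℕ} (hk : k < n) :
    grid R δ k + δ ≤ z := by
  rw [← grid_succ, hz]
  unfold grid
  have : ((k + 1 : ℕ) : ℝ) ≤ n := by exact_mod_cast hk
  nlinarith

lemma le_grid (hδ : 0 < δ) (hz : z = (n - R) * δ) {k : ℕ} (hk : n ≤ k) :
    z ≤ grid R δ k := by
  rw [hz]
  unfold grid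
  have : (n : ℝ) ≤ k := by exact_mod_cast hk
  nlinarith

lemma summable_indicator (ha : ∀ k, 0 ≤ a k) (ha1 : HasSum a 1) :
    Summable (fun k => a k * if k < n then (1 : ℝ) else 0) :=
  Summable.of_nonneg_of_le (fun k => mul_nonneg (ha k) (by split_ifs <;> norm_num))
    (fun k => mul_le_of_le_one_right (ha k) (by split_ifs <;> norm_num)) ha1.summable

/-- The constant test function gives E[z - min(x, z)] = z. In a state below n either z - x ≥ 1, or x
is within 1 of z and the truncated ramp used as second test function has slope 1; so the indicator
is at most that difference quotient plus z - min(x, z). -/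
lemma tsum_idle_le (hR : 0 < R) (hRn : R < n) (ha : ∀ k, 0 ≤ a k) (ha1 : HasSum a 1)
    (hbal : ∀ k, R * a k = (min (k + 1) n : ℕ) * a (k + 1)) (hδ : 0 < δ) (hδR : R * δ ^ 2 = 1)
    (hz : z = (n - R) * δ) :
    ∑' k, a k * (if k < n then (1 : ℝ) else 0) ≤ 2 * z := by
  have hz0 : 0 < z := by rw [hz]; exact mul_pos (by linarith) hδ
  obtain ⟨s1, t1⟩ := tsum_stein_eq_zero hR hRn ha hbal hδ hδR hz (g := fun _ => 1) (B := 1)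
    (C := 0) le_rfl (by simp)
  obtain ⟨s2, t2⟩ := tsum_stein_eq_zero hR hRn ha hbal hδ hδR hz
    (g := fun x => max (min x z - z) (-1)) (B := 1) (C := 0) le_rfl (fun x => by
      rw [zero_mul, add_zero]
      exact abs_le.2 ⟨le_max_right _ _, max_le (by linarith [min_le_right x z]) (by norm_num)⟩)
  have hsum : HasSum (fun k => a k * ((max (min (grid R δ k + δ) z - z) (-1)
      - max (min (grid R δ k) z - z) (-1)) / δ
      - min (grid R δ k) z * max (min (grid R δ k) z - z) (-1))
      + 2 * (z * a k + a k * ((1 - 1) / δ - min (grid R δ k) z * 1))) (0 + 2 * (z * 1 + 0)) := by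
    refine (t2 ▸ s2.hasSum).add (((ha1.mul_left z).add (t1 ▸ s1.hasSum)).mul_left 2)
  refine (hasSum_le (fun k => ?_) (summable_indicator ha ha1).hasSum hsum).trans_eq (by ring)
  set x := grid R δ k
  have hm := min_le_right x z
  have hmono : max (min x z - z) (-1) ≤ max (min (x + δ) z - z) (-1) := by
    gcongr; linarith
  have hg0 : max (min x z - z) (-1) ≤ 0 := max_le (by linarith) (by norm_num)
  have hg1 : -1 ≤ max (min x z - z) (-1) := le_max_right _ _
  -- The ramp takes values in [-1, 0], so the product is nonpositive if min(x, z) ≥ 0 and at most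
  -- -min(x, z) otherwise. This is the second copy of z - min(x, z).
  have hmg : min x z * max (min x z - z) (-1) ≤ z - min x z := by nlinarith
  have hkey : (if k < n then (1 : ℝ) else 0) ≤ (max (min (x + δ) z - z) (-1)
      - max (min x z - z) (-1)) / δ + (z - min x z) := by
    have hd : 0 ≤ (max (min (x + δ) z - z) (-1) - max (min x z - z) (-1)) / δ :=
      div_nonneg (by linarith) hδ.le
    split_ifs with hk
    · have hxz := grid_add_le hδ hz hk
      rcases le_total (x - z) (-1) with h | h
      · rw [min_eq_left (by linarith : x ≤ z)] at hd ⊢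
        linarith
      · rw [min_eq_left (by linarith : x ≤ z), min_eq_left hxz, max_eq_left h,
          max_eq_left (by linarith)]
        have : (x + δ - z - (x - z)) / δ = 1 := by field_simp; ring
        rw [this]
        linarith
    · linarith
  have h2 : (if k < n then (1 : ℝ) else 0) ≤ ((max (min (x + δ) z - z) (-1)
      - max (min x z - z) (-1)) / δ - min x z * max (min x z - z) (-1)) + 2 * (z - min x z) := by
    linarith
  refine (mul_le_mul_of_nonneg_left h2 (ha k)).trans_eq ?_
  ring

/-- Steady-state diffusion approximation for a sequence satisfying the balance equations. -/
theorem abs_tsum_sub_le (hR : 0 < R) (hRn : R < n) (ha : ∀ k, 0 ≤ a k) (ha1 : HasSum a 1)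
    (hbal : ∀ k, R * a k = (min (k + 1) n : ℕ) * a (k + 1)) (hδ : 0 < δ) (hδR : R * δ ^ 2 = 1)
    (hz : z = (n - R) * δ) {h : ℝ → ℝ} (hh : LipschitzWith 1 h) :
    Summable (fun k => a k * h (grid R δ k)) ∧
    |∑' k, a k * h (grid R δ k) - (∫ x, h x * dens z x) / ∫ x, dens z x| ≤ 30 * δ := by
  have hz0 : 0 < z := by rw [hz]; exact mul_pos (by linarith) hδ
  have hZ := integral_dens_pos hz0
  set Z := ∫ x, dens z x with hZdef
  have hid := integrable_dens hz0
  have hhb : ∀ x, |h x| ≤ |h 0| + 1 * |x| := fun x => by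
    have h1 := abs_sub_le_of_lipschitz hh x 0
    have h2 := abs_sub_abs_le_abs_sub (h x) (h 0)
    rw [sub_zero] at h1
    linarith
  have hih := integrable_mul_dens hz0 hh.continuous hhb
  have hiabs := integrable_mul_dens hz0 continuous_abs (B := 0) (C := 1) (by simp)
  obtain ⟨D, hD⟩ := exists_abs_grid_le hR.le hδ zero_le_one hhb
  have hsh := summable_mul_of_le hR.le hRn ha hbal hD
  refine ⟨hsh, ?_⟩
  set c := (∫ x, h x * dens z x) / Z with hc
  set A := (∫ x, |x| * dens z x) / Z with hAdef
  have hA0 : 0 ≤ A := div_nonneg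
    (integral_nonneg fun x => mul_nonneg (abs_nonneg _) (dens_pos z x).le) hZ.le
  have hA1 : A ≤ 1 + 1 / z := by
    rw [hAdef, div_le_iff₀ hZ]; exact integral_abs_mul_dens_le hz0
  have hk : LipschitzWith 1 fun x => h x - c := by
    refine LipschitzWith.of_dist_le_mul fun x y => ?_
    rw [Real.dist_eq, sub_sub_sub_cancel_right, ← Real.dist_eq]
    exact hh.dist_le_mul x y
  have hk0 : ∫ x, (h x - c) * dens z x = 0 := by
    simp_rw [sub_mul]
    rw [integral_sub hih (hid.const_mul c), integral_const_mul, ← hZdef, hc,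
      div_mul_cancel₀ _ hZ.ne', sub_self]
  -- Since c is the mean of h(Y), this is E|x - Y| ≤ |x| + E|Y|.
  have hkb : ∀ x, |h x - c| ≤ |x| + A := by
    intro x
    have e : h x - c = (∫ y, (h x - h y) * dens z y) / Z := by
      simp_rw [sub_mul]
      rw [integral_sub (hid.const_mul _) hih, integral_const_mul, ← hZdef, sub_div, ← hc,
        mul_div_cancel_right₀ _ hZ.ne']
    rw [e, abs_div, abs_of_pos hZ, div_le_iff₀ hZ, add_mul, hAdef, div_mul_cancel₀ _ hZ.ne',
      hZdef, ← integral_const_mul, ← integral_add (hid.const_mul _) hiabs]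
    rw [← Real.norm_eq_abs]
    refine norm_integral_le_of_norm_le ((hid.const_mul _).add hiabs) (ae_of_all _ fun y => ?_)
    rw [norm_mul, Real.norm_eq_abs, Real.norm_eq_abs, abs_of_pos (dens_pos z y), ← add_mul]
    exact mul_le_mul_of_nonneg_right ((abs_sub_le_of_lipschitz hh x y).trans (abs_sub _ _))
      (dens_pos z y).le
  obtain ⟨g, ⟨B, hB⟩, hg⟩ := exists_discrete_stein_solution hz0 hA0 hk hkb hk0
  obtain ⟨s1, t1⟩ := tsum_stein_eq_zero hR hRn ha hbal hδ hδR hz (g := g) (B := B) (C := 1 / z)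
    (by positivity) (fun x => (hB x).trans_eq (by ring))
  have hs : HasSum (fun k => a k * h (grid R δ k) - a k * c
      - a k * ((g (grid R δ k + δ) - g (grid R δ k)) / δ - min (grid R δ k) z * g (grid R δ k)))
      ((∑' k, a k * h (grid R δ k)) - 1 * c - 0) :=
    (hsh.hasSum.sub (ha1.mul_right c)).sub (t1 ▸ s1.hasSum)
  rw [one_mul, sub_zero] at hs
  set P := ∑' k, a k * (if k < n then (1 : ℝ) else 0) with hP
  have hP2 : P ≤ 2 * z := tsum_idle_le hR hRn ha ha1 hbal hδ hδR hz
  have hP1 : P ≤ 1 := hasSum_le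
    (fun k => mul_le_of_le_one_right (ha k) (by split_ifs <;> norm_num))
    (summable_indicator ha ha1).hasSum ha1
  have hP0 : 0 ≤ P := tsum_nonneg fun k => mul_nonneg (ha k) (by split_ifs <;> norm_num)
  have hbd : HasSum (fun k => 2 * δ * a k + (10 + 6 * A) * δ * (a k * if k < n then (1 : ℝ) else 0))
      (2 * δ * 1 + (10 + 6 * A) * δ * P) :=
    (ha1.mul_left _).add ((summable_indicator ha ha1).hasSum.mul_left _)
  have hle := hs.norm_le_of_bounded hbd fun k => by
    rw [← mul_sub, ← mul_sub, norm_mul, Real.norm_eq_abs, Real.norm_eq_abs, abs_of_nonneg (ha k),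
      abs_sub_comm]
    have hgk := hg δ hδ (grid R δ k)
    rw [sub_sub] at hgk
    have e : (g (grid R δ k + δ) - g (grid R δ k)) / δ - min (grid R δ k) z * g (grid R δ k)
        - (h (grid R δ k) - c) = (g (grid R δ k + δ) - g (grid R δ k)) / δ
        - (min (grid R δ k) z * g (grid R δ k) + (h (grid R δ k) - c)) := by ring
    rw [e]
    split_ifs with hkn
    · have := mul_le_mul_of_nonneg_left (hgk.1 (grid_add_le hδ hz hkn)) (ha k)
      have h3 : 0 ≤ δ * a k := mul_nonneg hδ.le (ha k)
      linarith
    · have := mul_le_mul_of_nonneg_left (hgk.2 (le_grid hδ hz (not_lt.1 hkn))) (ha k)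
      linarith
  rw [Real.norm_eq_abs] at hle
  refine hle.trans ?_
  -- The 1/z in A is paid for by P ≤ 2z.
  have h6 : A * P ≤ 3 := by
    calc A * P ≤ (1 + 1 / z) * P := by gcongr
      _ = P + P / z := by ring
      _ ≤ 1 + 2 := add_le_add hP1 (by rw [div_le_iff₀ hz0]; exact hP2)
      _ = 3 := by norm_num
  have h7 : 2 + (10 + 6 * A) * P ≤ 30 := by linarith
  have := mul_le_mul_of_nonneg_right h7 hδ.le
  linarith

end discrete

/-! ### Transition functions with bounded exit rates: stationarity through the generator. -/

lemma integrable_nat_of_abs_le {μ : Measure ℕ} [IsFiniteMeasure μ] {g : ℕ → ℝ} {M : ℝ}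
    (hg : ∀ i, |g i| ≤ M) : Integrable g μ :=
  Integrable.of_bound (measurable_of_countable g).aestronglyMeasurable M (ae_of_all _ hg)

lemma abs_integral_le_of_abs_le {μ : Measure ℕ} [IsProbabilityMeasure μ] {g : ℕ → ℝ} {M : ℝ}
    (hg : ∀ i, |g i| ≤ M) : |∫ i, g i ∂μ| ≤ M := by
  have := norm_integral_le_of_norm_le_const (μ := μ) (f := g) (ae_of_all _ hg)
  simpa using this

lemma integral_bind_nat {μ : Measure ℕ} [IsProbabilityMeasure μ] {κ : Kernel ℕ ℕ}
    [IsMarkovKernel κ] {g : ℕ → ℝ} {M : ℝ} (hg : ∀ i, |g i| ≤ M) :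
    ∫ i, g i ∂(μ.bind κ) = ∫ i, ∫ j, g j ∂(κ i) ∂μ := by
  have h := Kernel.integral_comp (η := κ) (κ := Kernel.const ℕ μ) (a := 0) (f := g)
    (integrable_nat_of_abs_le hg)
  rwa [Kernel.comp_apply, Kernel.const_apply] at h

section semigroup

variable {q : ℕ → ℕ → ℝ} {P : ℝ≥0 → Kernel ℕ ℕ}

lemma IsTransitionFunction.real_zero (hP : IsTransitionFunction q P) (i j : ℕ) :
    (P 0 i).real {j} = if i = j then 1 else 0 := by
  rw [hP.zero, Kernel.id_apply, measureReal_def, Measure.dirac_apply' _ (measurableSet_singleton _)]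
  by_cases h : i = j <;> simp [h]

lemma IsTransitionFunction.mul_le_add (hP : IsTransitionFunction q P) (s t : ℝ≥0) (i : ℕ) :
    (P s i).real {i} * (P t i).real {i} ≤ (P (s + t) i).real {i} := by
  have hs := hP.isMarkov s
  have ht := hP.isMarkov t
  have h : P t i {i} * P s i {i} ≤ P (s + t) i {i} := by
    rw [hP.add, Kernel.comp_apply' _ _ _ (measurableSet_singleton i)]
    calc P t i {i} * P s i {i} = ∫⁻ j in {i}, P t j {i} ∂(P s i) := by
          rw [lintegral_singleton]
      _ ≤ _ := setLIntegral_le_lintegral _ _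
  have hst := hP.isMarkov (s + t)
  rw [mul_comm, measureReal_def, measureReal_def, measureReal_def, ← ENNReal.toReal_mul]
  exact ENNReal.toReal_mono (measure_ne_top _ _) h

lemma IsTransitionFunction.pow_le (hP : IsTransitionFunction q P) (t : ℝ≥0) (i m : ℕ) :
    (P t i).real {i} ^ m ≤ (P (m * t) i).real {i} := by
  induction m with
  | zero => simp [hP.real_zero]
  | succ m ih =>
    have h := hP.mul_le_add (m * t) t i
    have e : (m : ℝ≥0) * t + t = ((m + 1 : ℕ) : ℝ≥0) * t := by push_cast; ring
    rw [e] at h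
    rw [pow_succ]
    exact (mul_le_mul_of_nonneg_right ih measureReal_nonneg).trans h

/-- The probability of having left a state is bounded by its exit rate times the elapsed time. -/
lemma IsTransitionFunction.one_sub_le (hP : IsTransitionFunction q P) (t : ℝ≥0) (i : ℕ) :
    1 - (P t i).real {i} ≤ -q i i * t := by
  rcases eq_or_ne t 0 with rfl | ht
  · simp [hP.real_zero]
  have ht' : (0 : ℝ) < t := by exact_mod_cast pos_iff_ne_zero.2 ht
  have hlim : Tendsto (fun m : ℕ => t / ((m : ℝ≥0) + 1)) atTop (𝓝[>] 0) := by
    refine tendsto_nhdsWithin_iff.2 ⟨?_, Eventually.of_forall fun m => ?_⟩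
    · rw [← NNReal.tendsto_coe]
      push_cast
      have := (tendsto_one_div_add_atTop_nhds_zero_nat (𝕜 := ℝ)).const_mul (t : ℝ)
      rw [mul_zero] at this
      refine this.congr fun m => by rw [mul_one_div]
    · exact div_pos (pos_iff_ne_zero.2 ht) (by positivity)
  have h2 := (((hP.rate i i).comp hlim).mul_const (t : ℝ)).const_add 1
  suffices h : 1 + q i i * t ≤ (P t i).real {i} by linarith
  refine le_of_tendsto h2 (Eventually.of_forall fun m => ?_)
  have hm := hP.isMarkov (t / ((m : ℝ≥0) + 1))
  have h3 := hP.pow_le (t / ((m : ℝ≥0) + 1)) i (m + 1)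
  have e : ((m + 1 : ℕ) : ℝ≥0) * (t / ((m : ℝ≥0) + 1)) = t := by
    push_cast; field_simp
  rw [e] at h3
  refine le_trans ?_ h3
  -- Staying put for m + 1 short periods is one way to be at i at time t; Bernoulli's inequality
  -- linearizes the power, and the short-time limit yields 1 + q_ii t.
  have h4 := one_add_mul_le_pow (a := (P (t / ((m : ℝ≥0) + 1)) i).real {i} - 1)
    (by linarith [measureReal_nonneg (μ := P (t / ((m : ℝ≥0) + 1)) i) (s := {i})]) (m + 1)
  rw [add_sub_cancel] at h4
  refine le_trans (le_of_eq ?_) h4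
  simp only [Function.comp, hP.real_zero, if_true]
  push_cast
  field_simp

lemma IsTransitionFunction.abs_integral_sub_le (hP : IsTransitionFunction q P) {g : ℕ → ℝ} {M : ℝ}
    (hg : ∀ i, |g i| ≤ M) (t : ℝ≥0) (i : ℕ) :
    |∫ j, g j ∂(P t i) - g i| ≤ 2 * M * (-q i i * t) := by
  have ht := hP.isMarkov t
  have hM : 0 ≤ M := (abs_nonneg _).trans (hg 0)
  have hgi := integrable_nat_of_abs_le (μ := P t i) hg
  have e : ∫ j, g j ∂(P t i) - g i = ∫ j, (g j - g i) ∂(P t i) := by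
    rw [integral_sub hgi (integrable_const _)]; simp
  have e2 : ∫ j, (g j - g i) ∂(P t i) = ∫ j in ({i} : Set ℕ)ᶜ, (g j - g i) ∂(P t i) := by
    rw [setIntegral_eq_integral_of_forall_compl_eq_zero]
    intro j hj
    simp only [Set.mem_compl_iff, Set.mem_singleton_iff, not_not] at hj
    simp [hj]
  rw [e, e2]
  have h := norm_setIntegral_le_of_norm_le_const (μ := P t i) (s := ({i} : Set ℕ)ᶜ) (C := 2 * M)
    (f := fun j => g j - g i) (measure_lt_top _ _) (fun j _ => by
      rw [Real.norm_eq_abs]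
      linarith [abs_sub (g j) (g i), hg j, hg i])
  rw [probReal_compl_eq_one_sub (measurableSet_singleton i)] at h
  refine h.trans ?_
  have := hP.one_sub_le t i
  gcongr

/-- The backward equation at time zero, for a bounded function and a state with finitely many
neighbours. -/
lemma IsTransitionFunction.tendsto_integral (hP : IsTransitionFunction q P) {g : ℕ → ℝ} {M : ℝ}
    (hg : ∀ i, |g i| ≤ M) {i : ℕ} {S : Finset ℕ} (hiS : i ∈ S) (hS : ∑ j ∈ S, q i j = 0) :
    Tendsto (fun t : ℝ≥0 => (∫ j, g j ∂(P t i) - g i) / (t : ℝ)) (𝓝[>] 0)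
      (𝓝 (∑ j ∈ S, q i j * g j)) := by
  have h1 : Tendsto (fun t : ℝ≥0 => ∑ j ∈ S, ((P t i).real {j} - (P 0 i).real {j}) / (t : ℝ) * g j)
      (𝓝[>] 0) (𝓝 (∑ j ∈ S, q i j * g j)) :=
    tendsto_finsetSum _ fun j _ => (hP.rate i j).mul_const _
  have h2 : Tendsto (fun t : ℝ≥0 => ∑ j ∈ S, ((P t i).real {j} - (P 0 i).real {j}) / (t : ℝ))
      (𝓝[>] 0) (𝓝 0) := by
    rw [← hS]; exact tendsto_finsetSum _ fun j _ => hP.rate i j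
  refine tendsto_of_tendsto_of_dist h1 ?_
  -- The rates out of i sum to zero over S, so the mass P_t puts outside S is o(t) and a bounded g
  -- does not see it.
  have h3 := (h2.const_mul (-M))
  rw [mul_zero] at h3
  refine squeeze_zero (fun _ => dist_nonneg) (fun t => ?_) h3
  have ht := hP.isMarkov t
  have hgi := integrable_nat_of_abs_le (μ := P t i) hg
  have hz : ∀ f : ℕ → ℝ, ∑ j ∈ S, (P 0 i).real {j} * f j = f i := fun f => by
    simp [hP.real_zero, hiS]
  have e1 : ∑ j ∈ S, ((P t i).real {j} - (P 0 i).real {j}) / (t : ℝ) * g j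
      = (∫ j in (S : Set ℕ), g j ∂(P t i) - g i) / t := by
    rw [setIntegral_finset S hgi.integrableOn, ← hz g, ← Finset.sum_sub_distrib, Finset.sum_div]
    refine Finset.sum_congr rfl fun j _ => ?_
    rw [smul_eq_mul]; ring
  have e2 : ∑ j ∈ S, ((P t i).real {j} - (P 0 i).real {j}) / (t : ℝ)
      = ((P t i).real S - 1) / t := by
    have h5 := hz fun _ => 1
    simp only [mul_one] at h5
    rw [← Finset.sum_div, Finset.sum_sub_distrib, h5, sum_measureReal_singleton]
  have e3 := integral_add_compl (μ := P t i) S.measurableSet hgi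
  have h4 := norm_setIntegral_le_of_norm_le_const (μ := P t i) (s := (S : Set ℕ)ᶜ) (C := M)
    (f := g) (measure_lt_top _ _) (fun j _ => hg j)
  rw [probReal_compl_eq_one_sub S.measurableSet, Real.norm_eq_abs] at h4
  rw [e1, e2, dist_comm, Real.dist_eq, ← sub_div, abs_div, NNReal.abs_eq, mul_div_assoc']
  refine div_le_div_of_nonneg_right ?_ t.2
  rw [← e3]
  refine le_trans (le_of_eq ?_) (h4.trans_eq (by ring))
  congr 1; ring

variable {π : Measure ℕ} [IsProbabilityMeasure π] {C : ℝ}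

lemma IsTransitionFunction.abs_integral_integral_sub_le (hP : IsTransitionFunction q P)
    (hq : ∀ i, -q i i ≤ C) {g : ℕ → ℝ} {M : ℝ} (hg : ∀ i, |g i| ≤ M) (t : ℝ≥0) :
    |∫ i, ∫ j, g j ∂(P t i) ∂π - ∫ i, g i ∂π| ≤ 2 * M * (C * t) := by
  have ht := hP.isMarkov t
  have hM : 0 ≤ M := (abs_nonneg _).trans (hg 0)
  have h1 : ∀ i, |∫ j, g j ∂(P t i)| ≤ M := fun i => abs_integral_le_of_abs_le hg
  rw [← integral_sub (integrable_nat_of_abs_le h1) (integrable_nat_of_abs_le hg)]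
  refine abs_integral_le_of_abs_le fun i => (hP.abs_integral_sub_le hg t i).trans ?_
  have := hq i
  gcongr

lemma IsTransitionFunction.tendsto_integral_integral (hP : IsTransitionFunction q P)
    (hq : ∀ i, -q i i ≤ C) {S : ℕ → Finset ℕ} (hiS : ∀ i, i ∈ S i)
    (hS : ∀ i, ∑ j ∈ S i, q i j = 0) {g : ℕ → ℝ} {M : ℝ} (hg : ∀ i, |g i| ≤ M) :
    Tendsto (fun t : ℝ≥0 => (∫ i, ∫ j, g j ∂(P t i) ∂π - ∫ i, g i ∂π) / (t : ℝ)) (𝓝[>] 0)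
      (𝓝 (∫ i, ∑ j ∈ S i, q i j * g j ∂π)) := by
  have hM : 0 ≤ M := (abs_nonneg _).trans (hg 0)
  have e : ∀ t : ℝ≥0, (∫ i, ∫ j, g j ∂(P t i) ∂π - ∫ i, g i ∂π) / (t : ℝ)
      = ∫ i, (∫ j, g j ∂(P t i) - g i) / (t : ℝ) ∂π := fun t => by
    have ht := hP.isMarkov t
    have h1 : ∀ i, |∫ j, g j ∂(P t i)| ≤ M := fun i => abs_integral_le_of_abs_le hg
    rw [integral_div, integral_sub (integrable_nat_of_abs_le h1) (integrable_nat_of_abs_le hg)]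
  simp_rw [e]
  refine tendsto_integral_filter_of_dominated_convergence (fun _ => 2 * M * C)
    (Eventually.of_forall fun t => (measurable_of_countable _).aestronglyMeasurable)
    ?_ (integrable_const _) (ae_of_all _ fun i => hP.tendsto_integral hg (hiS i) (hS i))
  filter_upwards [self_mem_nhdsWithin] with t ht
  have ht' : (0 : ℝ) < t := by exact_mod_cast ht
  refine ae_of_all _ fun i => ?_
  rw [Real.norm_eq_abs, abs_div, NNReal.abs_eq, div_le_iff₀ ht']
  refine (hP.abs_integral_sub_le hg t i).trans ?_
  have := mul_le_mul_of_nonneg_right (hq i) ht'.le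
  have := mul_le_mul_of_nonneg_left this (by positivity : 0 ≤ 2 * M)
  linarith

/-- Under invariance the difference quotient of ∫ P_t g dπ is identically zero, and the generator
integral is its limit. -/
lemma IsTransitionFunction.integral_generator_eq_zero (hP : IsTransitionFunction q P)
    (hq : ∀ i, -q i i ≤ C) {S : ℕ → Finset ℕ} (hiS : ∀ i, i ∈ S i)
    (hS : ∀ i, ∑ j ∈ S i, q i j = 0) (hπ : ∀ t, (P t).Invariant π) {g : ℕ → ℝ} {M : ℝ}
    (hg : ∀ i, |g i| ≤ M) : ∫ i, ∑ j ∈ S i, q i j * g j ∂π = 0 := by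
  refine tendsto_nhds_unique (hP.tendsto_integral_integral (π := π) hq hiS hS hg) ?_
  refine tendsto_const_nhds.congr fun t => ?_
  have ht := hP.isMarkov t
  have h := (hπ t).def
  have h2 : ∫ i, g i ∂(π.bind (P t)) = ∫ i, ∫ j, g j ∂(P t i) ∂π :=
    integral_bind_nat hg
  rw [h] at h2
  rw [← h2, sub_self, zero_div]

lemma IsTransitionFunction.integral_add (hP : IsTransitionFunction q P) {g : ℕ → ℝ} {M : ℝ}
    (hg : ∀ i, |g i| ≤ M) (s t : ℝ≥0) (i : ℕ) :
    ∫ j, g j ∂(P (s + t) i) = ∫ k, ∫ j, g j ∂(P s k) ∂(P t i) := by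
  have hs := hP.isMarkov s
  have ht := hP.isMarkov t
  rw [add_comm s t, hP.add, Kernel.integral_comp (integrable_nat_of_abs_le hg)]

/-- The function F(t) = ∫ P_t g dπ is Lipschitz, and its right derivative at s is the generator
applied to the bounded function P_s g and integrated against π, hence 0. So F is constant. -/
lemma IsTransitionFunction.integral_integral_eq (hP : IsTransitionFunction q P)
    (hq : ∀ i, -q i i ≤ C) {S : ℕ → Finset ℕ} (hiS : ∀ i, i ∈ S i)
    (hS : ∀ i, ∑ j ∈ S i, q i j = 0)
    (hπ : ∀ g : ℕ → ℝ, (∃ M, ∀ i, |g i| ≤ M) → ∫ i, ∑ j ∈ S i, q i j * g j ∂π = 0)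
    {g : ℕ → ℝ} {M : ℝ} (hg : ∀ i, |g i| ≤ M) (t : ℝ≥0) :
    ∫ i, ∫ j, g j ∂(P t i) ∂π = ∫ i, g i ∂π := by
  have hM : 0 ≤ M := (abs_nonneg _).trans (hg 0)
  -- The probability of having left state 0 by time 1 is nonnegative and at most C.
  have hC : 0 ≤ C := by
    have h1 := hP.one_sub_le 1 0
    have h2 := hP.isMarkov 1
    have h3 : (P 1 0).real {0} ≤ 1 := measureReal_le_one
    have h4 := hq 0
    norm_num at h1
    linarith
  set F : ℝ≥0 → ℝ := fun t => ∫ i, ∫ j, g j ∂(P t i) ∂π with hF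
  have hbd : ∀ t i, |∫ j, g j ∂(P t i)| ≤ M := fun t i => by
    have ht := hP.isMarkov t
    exact abs_integral_le_of_abs_le hg
  -- The short step h is taken first, directly from π, so that the hypothesis on π applies to P_s g.
  have hadd : ∀ s h, F (s + h) = ∫ i, ∫ k, ∫ j, g j ∂(P s k) ∂(P h i) ∂π := fun s h => by
    simp only [hF, hP.integral_add hg s h]
  have hlip : ∀ s h, |F (s + h) - F s| ≤ 2 * M * (C * h) := fun s h => by
    rw [hadd]
    exact hP.abs_integral_integral_sub_le hq (hbd s) h
  have hder : ∀ s, Tendsto (fun h : ℝ≥0 => (F (s + h) - F s) / (h : ℝ)) (𝓝[>] 0) (𝓝 0) :=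
    fun s => by
    simp_rw [hadd]
    rw [← hπ _ ⟨M, hbd s⟩]
    exact hP.tendsto_integral_integral hq hiS hS (hbd s)
  have hlip' : ∀ x y : ℝ≥0, x ≤ y → |F y - F x| ≤ 2 * M * C * (y - x : ℝ) := fun x y hxy => by
    have h := hlip x (y - x)
    rw [add_tsub_cancel_of_le hxy, NNReal.coe_sub hxy] at h
    linarith
  have hcont : Continuous F := by
    have : LipschitzWith (Real.toNNReal (2 * M * C)) F := by
      refine LipschitzWith.of_dist_le_mul fun x y => ?_
      rw [Real.coe_toNNReal _ (by positivity), Real.dist_eq, NNReal.dist_eq]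
      rcases le_total x y with h | h
      · rw [abs_sub_comm, abs_sub_comm (x : ℝ),
          abs_of_nonneg (sub_nonneg.2 (NNReal.coe_le_coe.2 h))]
        exact hlip' x y h
      · rw [abs_of_nonneg (sub_nonneg.2 (NNReal.coe_le_coe.2 h))]
        exact hlip' y x h
    exact this.continuous
  have hconst := constant_of_has_deriv_right_zero (f := fun r : ℝ => F r.toNNReal) (a := 0)
    (b := (t : ℝ)) (hcont.comp continuous_real_toNNReal).continuousOn (fun x hx => by
      rw [← hasDerivWithinAt_Ioi_iff_Ici, hasDerivWithinAt_iff_tendsto_slope' (by simp)]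
      have hmap : Tendsto (fun y : ℝ => (y - x).toNNReal) (𝓝[>] x) (𝓝[>] 0) := by
        refine tendsto_nhdsWithin_iff.2 ⟨?_, ?_⟩
        · have : Tendsto (fun y : ℝ => (y - x).toNNReal) (𝓝 x) (𝓝 (x - x).toNNReal) :=
            (continuous_real_toNNReal.comp (continuous_id.sub continuous_const)).tendsto x
          rw [sub_self, Real.toNNReal_zero] at this
          exact this.mono_left nhdsWithin_le_nhds
        · filter_upwards [self_mem_nhdsWithin] with y hy
          exact Real.toNNReal_pos.2 (sub_pos.2 hy)
      refine ((hder x.toNNReal).comp hmap).congr' ?_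
      filter_upwards [self_mem_nhdsWithin] with y hy
      have hxy : 0 ≤ y - x := (sub_pos.2 hy).le
      simp only [Function.comp, slope_def_field]
      rw [← Real.toNNReal_add hx.1 hxy, Real.coe_toNNReal _ hxy, add_sub_cancel]) t
    ⟨t.2, le_rfl⟩
  simp only [Real.toNNReal_coe, Real.toNNReal_zero] at hconst
  change F t = _
  rw [hconst, hF]
  simp only [hP.zero, Kernel.id_apply, integral_dirac]

/-- A probability measure annihilated by the generator is invariant. -/
lemma IsTransitionFunction.invariant (hP : IsTransitionFunction q P)
    (hq : ∀ i, -q i i ≤ C) {S : ℕ → Finset ℕ} (hiS : ∀ i, i ∈ S i)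
    (hS : ∀ i, ∑ j ∈ S i, q i j = 0)
    (hπ : ∀ g : ℕ → ℝ, (∃ M, ∀ i, |g i| ≤ M) → ∫ i, ∑ j ∈ S i, q i j * g j ∂π = 0)
    (t : ℝ≥0) : (P t).Invariant π := by
  have ht := hP.isMarkov t
  refine Measure.ext_of_singleton fun k => ?_
  have hg : ∀ i, |Set.indicator {k} (fun _ => (1 : ℝ)) i| ≤ 1 := fun i => by
    by_cases h : i = k <;> simp [h]
  have h := hP.integral_integral_eq (π := π) hq hiS hS hπ hg t
  rw [← integral_bind_nat hg,
    integral_indicator_const _ (measurableSet_singleton k),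
    integral_indicator_const _ (measurableSet_singleton k), smul_eq_mul, smul_eq_mul, mul_one,
    mul_one] at h
  exact (measureReal_eq_measureReal_iff).1 h

end semigroup

/-! ### Uniformization: constructing a chain from a jump kernel. -/

section

lemma isMarkovKernel_pow (K : Kernel ℕ ℕ) [IsMarkovKernel K] (k : ℕ) : IsMarkovKernel (K ^ k) := by
  induction k with
  | zero => rw [pow_zero]; exact inferInstanceAs (IsMarkovKernel Kernel.id)
  | succ k ih => rw [pow_succ]; exact inferInstanceAs (IsMarkovKernel ((K ^ k) ∘ₖ K))

/-- The transition function at time `t` of the chain that jumps according to `K` at the times of a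
Poisson process of rate `c`. -/
def uniformization (K : Kernel ℕ ℕ) (c t : ℝ≥0) : Kernel ℕ ℕ :=
  Kernel.ofFunOfCountable fun i => (poissonMeasure (c * t)).bind fun k => (K ^ k) i

lemma uniformization_apply (K : Kernel ℕ ℕ) (c t : ℝ≥0) (i : ℕ) :
    uniformization K c t i = (poissonMeasure (c * t)).bind fun k => (K ^ k) i := rfl

lemma lintegral_uniformization (K : Kernel ℕ ℕ) (c t : ℝ≥0) (i : ℕ) (f : ℕ → ℝ≥0∞) :
    ∫⁻ j, f j ∂(uniformization K c t i) =
      ∫⁻ k, ∫⁻ j, f j ∂((K ^ k) i) ∂(poissonMeasure (c * t)) := by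
  rw [uniformization_apply, Measure.lintegral_bind (measurable_of_countable _).aemeasurable
    (measurable_of_countable _).aemeasurable]

lemma uniformization_apply' (K : Kernel ℕ ℕ) (c t : ℝ≥0) (i : ℕ) (s : Set ℕ) :
    uniformization K c t i s = ∫⁻ k, (K ^ k) i s ∂(poissonMeasure (c * t)) := by
  rw [uniformization_apply, Measure.bind_apply (MeasurableSet.of_discrete)
    (measurable_of_countable _).aemeasurable]

lemma poissonMeasure_zero_eq_dirac : poissonMeasure 0 = Measure.dirac 0 := by
  refine Measure.ext_of_singleton fun k => ?_
  rw [poissonMeasure_singleton, Measure.dirac_apply' _ (measurableSet_singleton _)]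
  rcases eq_or_ne k 0 with rfl | hk
  · simp
  · simp [hk, hk.symm]

lemma uniformization_zero (K : Kernel ℕ ℕ) (c : ℝ≥0) : uniformization K c 0 = Kernel.id := by
  ext i s hs
  rw [uniformization_apply', mul_zero, poissonMeasure_zero_eq_dirac, lintegral_dirac, pow_zero]
  rfl

variable (K : Kernel ℕ ℕ) [IsMarkovKernel K] (c : ℝ≥0)

instance (t : ℝ≥0) : IsMarkovKernel (uniformization K c t) := by
  refine ⟨fun i => ⟨?_⟩⟩
  rw [uniformization_apply']
  have : ∀ k, (K ^ k) i Set.univ = 1 := fun k => by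
    have := isMarkovKernel_pow K k
    exact measure_univ
  simp [this]

/-- Poisson laws convolve by adding parameters, and powers of K multiply by adding exponents. -/
lemma uniformization_add (s t : ℝ≥0) :
    uniformization K c (s + t) = uniformization K c t ∘ₖ uniformization K c s := by
  ext i S hS
  have hpow : ∀ k, IsMarkovKernel (K ^ k) := isMarkovKernel_pow K
  rw [Kernel.comp_apply' _ _ _ hS, lintegral_uniformization, uniformization_apply', mul_add,
    ← poissonMeasure_conv_poissonMeasure, Measure.lintegral_conv (measurable_of_countable _)]
  refine lintegral_congr fun a => ?_
  simp_rw [uniformization_apply']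
  rw [lintegral_lintegral_swap (measurable_of_countable _).aemeasurable]
  refine lintegral_congr fun b => ?_
  rw [Kernel.pow_add_apply_eq_lintegral _ _ _ _ hS]

lemma abs_exp_neg_mul_add_sub_le {r f₀ f₁ : ℝ} (hr : 0 ≤ r) (h₀ : |f₀| ≤ 1) (h₁ : |f₁| ≤ 1) :
    |Real.exp (-r) * (f₀ + r * f₁) - (f₀ + r * (f₁ - f₀))| ≤ 2 * r ^ 2 := by
  have e1 : 1 - r ≤ Real.exp (-r) := by linarith [Real.add_one_le_exp (-r)]
  have e2 : Real.exp (-r) * (1 + r) ≤ 1 := by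
    have := Real.add_one_le_exp r
    rw [Real.exp_neg, inv_mul_le_one₀ (Real.exp_pos _)]
    linarith
  have e3 : Real.exp (-r) ≤ 1 := Real.exp_le_one_iff.2 (by linarith)
  have a1 : |Real.exp (-r) - 1 + r| ≤ r ^ 2 := by
    rw [abs_of_nonneg (by linarith)]
    nlinarith
  have a2 : |r * (Real.exp (-r) - 1)| ≤ r ^ 2 := by
    rw [abs_le]; constructor <;> nlinarith
  have e : Real.exp (-r) * (f₀ + r * f₁) - (f₀ + r * (f₁ - f₀))
      = (Real.exp (-r) - 1 + r) * f₀ + (r * (Real.exp (-r) - 1)) * f₁ := by ring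
  rw [e]
  refine (abs_add_le _ _).trans ?_
  rw [abs_mul, abs_mul (r * _)]
  have b1 := mul_le_mul a1 h₀ (abs_nonneg _) (sq_nonneg r)
  have b2 := mul_le_mul a2 h₁ (abs_nonneg _) (sq_nonneg r)
  linarith

/-- A Poisson average is approximated to second order by its first two terms. -/
lemma abs_integral_poissonMeasure_sub_le (r : ℝ≥0) {f : ℕ → ℝ} (h0 : ∀ k, 0 ≤ f k)
    (h1 : ∀ k, f k ≤ 1) :
    |∫ k, f k ∂(poissonMeasure r) - (f 0 + r * (f 1 - f 0))| ≤ 3 * (r : ℝ) ^ 2 := by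
  have hab : ∀ k, |f k| ≤ 1 := fun k => abs_le.2 ⟨by linarith [h0 k], h1 k⟩
  have hs := hasSum_integral_poissonMeasure (integrable_nat_of_abs_le (μ := poissonMeasure r) hab)
  have hs1 := hasSum_one_poissonMeasure r
  have ht := (hasSum_nat_add_iff' 2).2 hs
  have ht1 := (hasSum_nat_add_iff' 2).2 hs1
  simp only [Finset.sum_range_succ, Finset.sum_range_zero, zero_add, pow_zero, pow_one,
    Nat.factorial_zero, Nat.factorial_one, Nat.cast_one, div_one, mul_one, smul_eq_mul] at ht ht1
  have hle := hasSum_le (fun k => mul_le_of_le_one_right (by positivity) (h1 (k + 2))) ht ht1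
  have hge := ht.nonneg fun k => mul_nonneg (by positivity) (h0 (k + 2))
  have hr : (0 : ℝ) ≤ r := r.2
  have e1 : 1 - (r : ℝ) ≤ Real.exp (-r) := by linarith [Real.add_one_le_exp (-(r : ℝ))]
  have h3 := abs_exp_neg_mul_add_sub_le hr (hab 0) (hab 1)
  rw [abs_le] at h3 ⊢
  constructor <;> nlinarith

lemma tendsto_uniformization (i j : ℕ) :
    Tendsto (fun t : ℝ≥0 => ((uniformization K c t i).real {j}
      - (uniformization K c 0 i).real {j}) / (t : ℝ)) (𝓝[>] 0)
      (𝓝 (c * ((K i).real {j} - if i = j then 1 else 0))) := by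
  have hpow : ∀ k, IsMarkovKernel (K ^ k) := isMarkovKernel_pow K
  have hrep : ∀ t, (uniformization K c t i).real {j}
      = ∫ k, ((K ^ k) i).real {j} ∂(poissonMeasure (c * t)) := fun t => by
    rw [measureReal_def, uniformization_apply', ← integral_toReal
      (measurable_of_countable _).aemeasurable (ae_of_all _ fun k => measure_lt_top _ _)]
    rfl
  have h0 : (uniformization K c 0 i).real {j} = if i = j then 1 else 0 := by
    rw [uniformization_zero, Kernel.id_apply, measureReal_def,
      Measure.dirac_apply' _ (measurableSet_singleton _)]
    by_cases h : i = j <;> simp [h]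
  have hK0 : ((K ^ 0) i).real {j} = if i = j then 1 else 0 := by
    rw [← h0, uniformization_zero, pow_zero]; rfl
  have hlim : Tendsto (fun t : ℝ≥0 => 3 * (c : ℝ) ^ 2 * (t : ℝ)) (𝓝[>] 0) (𝓝 0) := by
    have : Tendsto (fun t : ℝ≥0 => 3 * (c : ℝ) ^ 2 * (t : ℝ)) (𝓝 0)
        (𝓝 (3 * (c : ℝ) ^ 2 * (0 : ℝ≥0))) :=
      (continuous_const.mul NNReal.continuous_coe).tendsto 0
    rw [NNReal.coe_zero, mul_zero] at this
    exact this.mono_left nhdsWithin_le_nhds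
  rw [tendsto_iff_dist_tendsto_zero]
  refine squeeze_zero' (Eventually.of_forall fun _ => dist_nonneg) ?_ hlim
  filter_upwards [self_mem_nhdsWithin] with t ht
  have ht' : (0 : ℝ) < t := by exact_mod_cast ht
  have h := abs_integral_poissonMeasure_sub_le (c * t) (f := fun k => ((K ^ k) i).real {j})
    (fun k => measureReal_nonneg) (fun k => measureReal_le_one)
  rw [← hrep, hK0, pow_one] at h
  rw [h0, Real.dist_eq, div_sub' ht'.ne', abs_div, abs_of_pos ht', div_le_iff₀ ht']
  push_cast at h
  refine le_trans (le_of_eq ?_) (h.trans_eq (by ring))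
  congr 1; ring

theorem isTransitionFunction_uniformization {q : ℕ → ℕ → ℝ}
    (hq : ∀ i j, q i j = c * ((K i).real {j} - if i = j then 1 else 0)) :
    IsTransitionFunction q (uniformization K c) where
  isMarkov t := inferInstance
  zero := uniformization_zero K c
  add := uniformization_add K c
  rate i j := by rw [hq]; exact tendsto_uniformization K c i j

end

/-! ### The Erlang-C chain: existence, balance, unique stationary law. -/

section chain

variable {n : ℕ} {lam mu : ℝ}

lemma sum_rate_mul (n : ℕ) (lam mu : ℝ) (g : ℕ → ℝ) (i : ℕ) :
    ∑ j ∈ Finset.range (i + 2), rate n lam mu i j * g j =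
      lam * (g (i + 1) - g i) - mu * (min i n : ℕ) * (g i - g (i - 1)) := by
  rw [Finset.sum_range_succ, Finset.sum_range_succ]
  have h1 : rate n lam mu i (i + 1) = lam := if_pos rfl
  have h2 : rate n lam mu i i = -(lam + mu * (min i n : ℕ)) := by simp [rate]
  rw [h1, h2]
  rcases i with _ | k
  · simp; ring
  · rw [Finset.sum_range_succ, Finset.sum_eq_zero]
    · have h3 : rate n lam mu (k + 1) k = mu * (min (k + 1) n : ℕ) := by
        rw [rate, if_neg (by omega), if_pos rfl]
      rw [h3, Nat.add_sub_cancel]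
      ring
    · intro j hj
      rw [Finset.mem_range] at hj
      have : rate n lam mu (k + 1) j = 0 := by
        unfold rate
        rw [if_neg (by omega), if_neg (by omega), if_neg (by omega)]
      rw [this, zero_mul]

lemma sum_rate (n : ℕ) (lam mu : ℝ) (i : ℕ) :
    ∑ j ∈ Finset.range (i + 2), rate n lam mu i j = 0 := by
  simpa using sum_rate_mul n lam mu (fun _ => 1) i

lemma neg_rate_self_le (hmu : 0 < mu) (i : ℕ) : -rate n lam mu i i ≤ lam + mu * n := by
  have h2 : rate n lam mu i i = -(lam + mu * (min i n : ℕ)) := by simp [rate]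
  rw [h2, neg_neg]
  have : ((min i n : ℕ) : ℝ) ≤ n := by exact_mod_cast min_le_right i n
  gcongr

/-- The jump kernel of the uniformized chain. -/
def jumpKernel (n : ℕ) (lam mu : ℝ) : Kernel ℕ ℕ :=
  Kernel.ofFunOfCountable fun i =>
    ENNReal.ofReal (lam / (lam + mu * n)) • Measure.dirac (i + 1) +
    ENNReal.ofReal (mu * (min i n : ℕ) / (lam + mu * n)) • Measure.dirac (i - 1) +
    ENNReal.ofReal (mu * (n - (min i n : ℕ)) / (lam + mu * n)) • Measure.dirac i

lemma jumpKernel_apply_real (hlam : 0 < lam) (hmu : 0 < mu) (i : ℕ) (s : Set ℕ)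
    [DecidablePred (· ∈ s)] :
    (jumpKernel n lam mu i).real s =
      lam / (lam + mu * n) * (if i + 1 ∈ s then 1 else 0) +
      mu * (min i n : ℕ) / (lam + mu * n) * (if i - 1 ∈ s then 1 else 0) +
      mu * (n - (min i n : ℕ)) / (lam + mu * n) * (if i ∈ s then 1 else 0) := by
  have hs : MeasurableSet s := MeasurableSet.of_discrete
  have hm : ((min i n : ℕ) : ℝ) ≤ n := by exact_mod_cast min_le_right i n
  have hd : ∀ k : ℕ, (Measure.dirac k).real s = if k ∈ s then 1 else 0 := fun k => by
    rw [measureReal_def, Measure.dirac_apply' _ hs]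
    by_cases h : k ∈ s <;> simp [h]
  have hf : ∀ (r : ℝ) (k : ℕ), IsFiniteMeasure (ENNReal.ofReal r • Measure.dirac k) := fun r k =>
    ⟨by simp [ENNReal.ofReal_lt_top]⟩
  change (_ + _ + _ : Measure ℕ).real s = _
  rw [measureReal_add_apply, measureReal_add_apply, measureReal_ennreal_smul_apply,
    measureReal_ennreal_smul_apply, measureReal_ennreal_smul_apply, hd, hd, hd,
    ENNReal.toReal_ofReal (by positivity), ENNReal.toReal_ofReal (by positivity),
    ENNReal.toReal_ofReal (div_nonneg (mul_nonneg hmu.le (sub_nonneg.2 hm)) (by positivity))]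

lemma isMarkovKernel_jumpKernel (hlam : 0 < lam) (hmu : 0 < mu) :
    IsMarkovKernel (jumpKernel n lam mu) := by
  refine ⟨fun i => ⟨?_⟩⟩
  have h := jumpKernel_apply_real (n := n) hlam hmu i Set.univ
  have hpos : 0 < lam + mu * n := by positivity
  have h1 : (jumpKernel n lam mu i).real Set.univ = 1 := by
    rw [h]; simp only [Set.mem_univ, if_true]; field_simp; ring
  rw [measureReal_def, ENNReal.toReal_eq_one_iff] at h1
  exact h1

/-- The clock rate `lam + mu * n` dominates every exit rate, so the unused rate becomes a holding
probability. In state 0 the truncated downward jump has weight 0. -/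
theorem exists_isTransitionFunction (n : ℕ) (hlam : 0 < lam) (hmu : 0 < mu) :
    ∃ P, IsTransitionFunction (rate n lam mu) P := by
  have hK := isMarkovKernel_jumpKernel (n := n) hlam hmu
  have hpos : 0 < lam + mu * n := by positivity
  refine ⟨_, isTransitionFunction_uniformization (jumpKernel n lam mu)
    (lam + mu * n).toNNReal fun i j => ?_⟩
  rw [Real.coe_toNNReal _ hpos.le, jumpKernel_apply_real hlam hmu]
  simp only [Set.mem_singleton_iff, rate]
  rcases i with _ | k
  · rcases j with _ | _ | j
    · simp; field_simp; ring
    · simp; field_simp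
    · simp
  · rw [Nat.add_sub_cancel]
    by_cases h1 : j = k + 1 + 1
    · rw [if_pos h1, if_pos h1.symm, if_neg (by omega), if_neg (by omega)]
      field_simp; ring
    · rw [if_neg h1, if_neg (Ne.symm h1)]
      by_cases h2 : k = j
      · rw [if_pos (by omega), if_pos h2, if_neg (by omega)]
        field_simp; ring
      · rw [if_neg (by omega), if_neg h2]
        by_cases h3 : k + 1 = j
        · rw [if_pos h3, if_pos h3]
          field_simp; ring
        · rw [if_neg h3, if_neg h3]; ring

variable {P : ℝ≥0 → Kernel ℕ ℕ} {π : Measure ℕ}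

/-- Stationary distributions satisfy the detailed balance equations. -/
lemma IsStationary.balance (hmu : 0 < mu) (hP : IsTransitionFunction (rate n lam mu) P)
    (hπ : IsStationary P π) (k : ℕ) :
    lam / mu * π.real {k} = (min (k + 1) n : ℕ) * π.real {k + 1} := by
  have := hπ.1
  -- The indicator of {0, …, k} turns the generator identity into equality of flows across the cut
  -- between k and k + 1.
  have h := hP.integral_generator_eq_zero (π := π) (neg_rate_self_le hmu)
    (S := fun i => Finset.range (i + 2)) (fun i => by simp) (sum_rate n lam mu) hπ.2
    (g := fun i => if i ≤ k then 1 else 0) (M := 1) (fun i => by split_ifs <;> simp)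
  have e : ∀ i, ∑ j ∈ Finset.range (i + 2), rate n lam mu i j * (if j ≤ k then 1 else 0)
      = Set.indicator {k + 1} (fun _ => mu * (min (k + 1) n : ℕ)) i
        - Set.indicator {k} (fun _ => lam) i := by
    intro i
    rw [sum_rate_mul n lam mu (fun j => if j ≤ k then 1 else 0)]
    rcases lt_trichotomy i k with h | rfl | h
    · rw [if_pos (by omega), if_pos h.le, if_pos (by omega),
        Set.indicator_of_notMem (by simp; omega), Set.indicator_of_notMem (by simp; omega)]
      ring
    · rw [if_neg (by omega), if_pos le_rfl, if_pos (by omega),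
        Set.indicator_of_notMem (by simp), Set.indicator_of_mem (by simp)]
      ring
    · rcases eq_or_ne i (k + 1) with rfl | h'
      · rw [if_neg (by omega), if_neg (by omega), if_pos (by omega),
          Set.indicator_of_mem (by simp), Set.indicator_of_notMem (by simp)]
        ring
      · rw [if_neg (by omega), if_neg (by omega), if_neg (by omega),
          Set.indicator_of_notMem (by simp; omega), Set.indicator_of_notMem (by simp; omega)]
        ring
  simp_rw [e] at h
  rw [integral_sub ((integrable_const _).indicator (measurableSet_singleton _))
    ((integrable_const _).indicator (measurableSet_singleton _)),
    integral_indicator_const _ (measurableSet_singleton _),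
    integral_indicator_const _ (measurableSet_singleton _), smul_eq_mul, smul_eq_mul] at h
  field_simp
  linarith

lemma integrable_nat_iff {π : Measure ℕ} [IsFiniteMeasure π] {f : ℕ → ℝ} :
    Integrable f π ↔ Summable fun k => π.real {k} * |f k| := by
  conv_lhs => rw [← Measure.sum_smul_dirac π]
  rw [integrable_sum_dirac_iff fun k => measure_ne_top _ _]
  rfl

lemma hasSum_real_singleton (π : Measure ℕ) [IsProbabilityMeasure π] :
    HasSum (fun k => π.real {k}) 1 := by
  have h1 : Integrable (fun _ : ℕ => (1 : ℝ)) π := integrable_const _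
  have h2 := integral_countable h1
  have h3 := integrable_nat_iff.1 h1
  simp only [integral_const, probReal_univ, smul_eq_mul, mul_one] at h2
  simp only [abs_one, mul_one] at h3
  rw [h2]
  exact h3.hasSum

lemma isStationary_of_balance (hlam : 0 < lam) (hmu : 0 < mu) (hRn : lam / mu < n)
    (hP : IsTransitionFunction (rate n lam mu) P) [IsProbabilityMeasure π]
    (hbal : ∀ k, lam / mu * π.real {k} = (min (k + 1) n : ℕ) * π.real {k + 1}) :
    IsStationary P π := by
  refine ⟨inferInstance, fun t => hP.invariant (neg_rate_self_le hmu)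
    (S := fun i => Finset.range (i + 2)) (fun i => by simp) (sum_rate n lam mu) ?_ t⟩
  rintro g ⟨M, hM⟩
  have hM0 : 0 ≤ M := (abs_nonneg _).trans (hM 0)
  -- The generator acts on g through its backward difference, so the summation identity for balanced
  -- sequences applies with this u.
  have hu : ∀ k, |g k - g (k - 1)| ≤ 2 * M := fun k => by
    linarith [abs_sub (g k) (g (k - 1)), hM k, hM (k - 1)]
  obtain ⟨-, h⟩ := tsum_generator_eq_zero (div_pos hlam hmu).le hRn (fun k => measureReal_nonneg)
    hbal (u := fun k => g k - g (k - 1)) (B := 2 * M) (fun k => (hu k).trans (by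
      have : 0 ≤ M * (k : ℝ) := by positivity
      linarith))
  have e : ∀ i, ∑ j ∈ Finset.range (i + 2), rate n lam mu i j * g j
      = mu * (lam / mu * (g (i + 1) - g (i + 1 - 1)) - (min i n : ℕ) * (g i - g (i - 1))) := by
    intro i
    rw [sum_rate_mul, Nat.add_sub_cancel]
    field_simp
  simp_rw [e]
  rw [integral_const_mul, integral_countable, mul_eq_zero]
  · right
    simpa only [smul_eq_mul] using h
  · refine integrable_nat_of_abs_le (M := lam / mu * (2 * M) + n * (2 * M)) fun i => ?_
    refine (abs_sub _ _).trans ?_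
    rw [abs_mul, abs_mul, abs_of_pos (div_pos hlam hmu), Nat.abs_cast]
    have hm : ((min i n : ℕ) : ℝ) ≤ n := by exact_mod_cast min_le_right i n
    have := hu i
    have := hu (i + 1)
    gcongr

/-- The unnormalized stationary distribution. -/
def stationaryWeight (n : ℕ) (R : ℝ) : ℕ → ℝ
  | 0 => 1
  | k + 1 => R * stationaryWeight n R k / (min (k + 1) n : ℕ)

lemma stationaryWeight_pos (hn : 1 ≤ n) {R : ℝ} (hR : 0 < R) (k : ℕ) :
    0 < stationaryWeight n R k := by
  induction k with
  | zero => exact one_pos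
  | succ k ih =>
    have : 0 < ((min (k + 1) n : ℕ) : ℝ) := by
      exact_mod_cast lt_min (Nat.succ_pos k) hn
    exact div_pos (mul_pos hR ih) this

lemma stationaryWeight_balance (hn : 1 ≤ n) (R : ℝ) (k : ℕ) :
    R * stationaryWeight n R k = (min (k + 1) n : ℕ) * stationaryWeight n R (k + 1) := by
  have : ((min (k + 1) n : ℕ) : ℝ) ≠ 0 := by
    exact_mod_cast (lt_min (Nat.succ_pos k) hn).ne'
  rw [stationaryWeight, mul_div_cancel₀ _ this]

lemma exists_balance {R : ℝ} (hn : 1 ≤ n) (hR : 0 < R) (hRn : R < n) :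
    ∃ π : Measure ℕ, IsProbabilityMeasure π ∧
      ∀ k, R * π.real {k} = (min (k + 1) n : ℕ) * π.real {k + 1} := by
  have hw := stationaryWeight_pos hn hR
  have hbal := stationaryWeight_balance hn R
  have hs : Summable (stationaryWeight n R) :=
    Summable.of_nonneg_of_le (fun k => (hw k).le)
      (fun k => le_mul_of_one_le_left (hw k).le (by
        have : (0 : ℝ) ≤ k := Nat.cast_nonneg k
        linarith))
      (summable_of_balance hR.le hRn (fun k => (hw k).le) hbal)
  have hW : 0 < ∑' k, stationaryWeight n R k := hs.tsum_pos (fun k => (hw k).le) 0 (hw 0)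
  set W := ∑' k, stationaryWeight n R k with hWdef
  have h1 : HasSum (fun k => stationaryWeight n R k / W) 1 := by
    have := hs.hasSum.div_const W
    rwa [← hWdef, div_self hW.ne'] at this
  have h0 : ∀ k, 0 ≤ stationaryWeight n R k / W := fun k => div_nonneg (hw k).le hW.le
  refine ⟨Measure.sum fun k => ENNReal.ofReal (stationaryWeight n R k / W) • Measure.dirac k,
    ⟨?_⟩, fun k => ?_⟩
  · rw [Measure.sum_apply _ MeasurableSet.univ]
    simp only [Measure.smul_apply, measure_univ, smul_eq_mul, mul_one]
    rw [← ENNReal.ofReal_tsum_of_nonneg h0 h1.summable, h1.tsum_eq, ENNReal.ofReal_one]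
  · rw [measureReal_def, measureReal_def, Measure.sum_smul_dirac_singleton,
      Measure.sum_smul_dirac_singleton, ENNReal.toReal_ofReal (h0 k), ENNReal.toReal_ofReal (h0 _),
      mul_div_assoc', hbal k, mul_div_assoc]

/-- Balance is a first-order recursion, so its solutions are proportional; total mass 1 fixes the
factor and excludes zero mass at state 0. -/
lemma eq_of_balance {R : ℝ} (hn : 1 ≤ n) {π ν : Measure ℕ} [IsProbabilityMeasure π]
    [IsProbabilityMeasure ν]
    (hπ : ∀ k, R * π.real {k} = (min (k + 1) n : ℕ) * π.real {k + 1})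
    (hν : ∀ k, R * ν.real {k} = (min (k + 1) n : ℕ) * ν.real {k + 1}) : π = ν := by
  have hprop : ∀ k, π.real {k} * ν.real {0} = ν.real {k} * π.real {0} := by
    intro k
    induction k with
    | zero => ring
    | succ k ih =>
      have hne : ((min (k + 1) n : ℕ) : ℝ) ≠ 0 := by
        exact_mod_cast (lt_min (Nat.succ_pos k) hn).ne'
      refine mul_left_cancel₀ hne ?_
      rw [← mul_assoc, ← mul_assoc, ← hπ k, ← hν k, mul_assoc, mul_assoc, ih]
  have hsπ := hasSum_real_singleton π
  have hsν := hasSum_real_singleton ν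
  have h00 : ν.real {0} = π.real {0} := by
    have h1 := hsπ.mul_right (ν.real {0})
    simp_rw [hprop] at h1
    have := h1.unique (hsν.mul_right (π.real {0}))
    linarith
  rw [h00] at hprop
  have hpos : π.real {0} ≠ 0 := by
    intro h
    have hall : ∀ k, π.real {k} = 0 := by
      intro k
      induction k with
      | zero => exact h
      | succ k ih =>
        have hne : ((min (k + 1) n : ℕ) : ℝ) ≠ 0 := by
          exact_mod_cast (lt_min (Nat.succ_pos k) hn).ne'
        have := hπ k
        rw [ih, mul_zero] at this
        exact (mul_eq_zero.1 this.symm).resolve_left hne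
    simp_rw [hall] at hsπ
    exact zero_ne_one (hasSum_zero.unique hsπ)
  refine Measure.ext_of_singleton fun k => ?_
  exact (measureReal_eq_measureReal_iff).1 (mul_right_cancel₀ hpos (hprop k))

theorem existsUnique_isStationary (hn : 1 ≤ n) (hlam : 0 < lam) (hmu : 0 < mu)
    (hRn : lam / mu < n) (hP : IsTransitionFunction (rate n lam mu) P) :
    ∃! π : Measure ℕ, IsStationary P π := by
  obtain ⟨π, hπ, hbal⟩ := exists_balance hn (div_pos hlam hmu) hRn
  refine ⟨π, isStationary_of_balance hlam hmu hRn hP hbal, fun ν hν => ?_⟩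
  have := hν.1
  exact eq_of_balance hn (hν.balance hmu hP) hbal

end chain

/-! ### The law of the diffusion model. -/

section diffusion

variable {n : ℕ} {lam mu z : ℝ}

lemma diffusionLaw_eq (hmu : mu ≠ 0) (hz : 0 < z) (hzeta : zeta n lam mu = -z) :
    diffusionLaw n lam mu =
      volume.withDensity fun x => ENNReal.ofReal (dens z x / ∫ y, dens z y) := by
  unfold diffusionLaw kappa
  rw [weight_eq_dens hmu hz.le hzeta]
  simp_rw [inv_mul_eq_div]

lemma isProbabilityMeasure_diffusionLaw (hmu : mu ≠ 0) (hz : 0 < z)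
    (hzeta : zeta n lam mu = -z) : IsProbabilityMeasure (diffusionLaw n lam mu) := by
  rw [diffusionLaw_eq hmu hz hzeta]
  refine ⟨?_⟩
  rw [withDensity_apply _ MeasurableSet.univ, Measure.restrict_univ,
    ← ofReal_integral_eq_lintegral_ofReal ((integrable_dens hz).div_const _)
      (ae_of_all _ fun x => div_nonneg (dens_pos z x).le (integral_dens_pos hz).le),
    integral_div, div_self (integral_dens_pos hz).ne', ENNReal.ofReal_one]

lemma measurable_ofReal_dens_div (z c : ℝ) :
    Measurable fun x => ENNReal.ofReal (dens z x / c) :=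
  ((continuous_dens z).measurable.div_const _).ennreal_ofReal

lemma integral_diffusionLaw (hmu : mu ≠ 0) (hz : 0 < z) (hzeta : zeta n lam mu = -z)
    (h : ℝ → ℝ) :
    ∫ x, h x ∂(diffusionLaw n lam mu) = (∫ x, h x * dens z x) / ∫ x, dens z x := by
  rw [diffusionLaw_eq hmu hz hzeta, integral_withDensity_eq_integral_toReal_smul
    (measurable_ofReal_dens_div _ _) (ae_of_all _ fun x => ENNReal.ofReal_lt_top), ← integral_div]
  refine integral_congr_ae (ae_of_all _ fun x => ?_)
  simp only
  rw [ENNReal.toReal_ofReal (div_nonneg (dens_pos z x).le (integral_dens_pos hz).le), smul_eq_mul]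
  ring

lemma integrable_diffusionLaw (hmu : mu ≠ 0) (hz : 0 < z) (hzeta : zeta n lam mu = -z) :
    Integrable (fun x : ℝ => x) (diffusionLaw n lam mu) := by
  rw [diffusionLaw_eq hmu hz hzeta, integrable_withDensity_iff
    (measurable_ofReal_dens_div _ _) (ae_of_all _ fun x => ENNReal.ofReal_lt_top)]
  have h := (integrable_mul_dens hz continuous_id (B := 0) (C := 1) (by simp)).div_const
    (∫ x, dens z x)
  refine h.congr (ae_of_all _ fun x => ?_)
  simp only [id]
  rw [ENNReal.toReal_ofReal (div_nonneg (dens_pos z x).le (integral_dens_pos hz).le)]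
  ring

end diffusion

end ErlangC

end

/-! ### Assembly. -/

theorem theorem1 (n : ℕ) (lam mu : ℝ) (hn : 1 ≤ n) (hlam : 0 < lam) (hmu : 0 < mu)
    (hR1 : 1 ≤ lam / mu) (hRn : lam / mu < n) :
    -- the chain exists
    (∃ P, ErlangC.IsTransitionFunction (ErlangC.rate n lam mu) P) ∧
    -- the law of `Y(∞)` is a probability measure with finite mean
    IsProbabilityMeasure (ErlangC.diffusionLaw n lam mu) ∧
    Integrable (fun y : ℝ => y) (ErlangC.diffusionLaw n lam mu) ∧
    ∀ P, ErlangC.IsTransitionFunction (ErlangC.rate n lam mu) P →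
      -- the chain has exactly one stationary distribution
      (∃! π : Measure ℕ, ErlangC.IsStationary P π) ∧
      ∀ π : Measure ℕ, ErlangC.IsStationary P π →
        Integrable (fun k : ℕ => (k : ℝ)) π ∧
        ErlangC.wasserstein (ErlangC.scaledLaw (lam / mu) π) (ErlangC.diffusionLaw n lam mu)
          ≤ ENNReal.ofReal (205 / √(lam / mu)) ∧
        |(∫ k : ℕ, (k : ℝ) ∂π)
            - (lam / mu + √(lam / mu) * ∫ y, y ∂(ErlangC.diffusionLaw n lam mu))| ≤ 205 := by
  have hR : 0 < lam / mu := div_pos hlam hmu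
  have hsq : 0 < √(lam / mu) := Real.sqrt_pos.2 hR
  have hδ : 0 < 1 / √(lam / mu) := by positivity
  have hδR : lam / mu * (1 / √(lam / mu)) ^ 2 = 1 := by
    rw [div_pow, Real.sq_sqrt hR.le, one_pow, mul_one_div, div_self hR.ne']
  obtain ⟨z, hz⟩ : ∃ z, z = (n - lam / mu) * (1 / √(lam / mu)) := ⟨_, rfl⟩
  have hz0 : 0 < z := by rw [hz]; exact mul_pos (by linarith) hδ
  have hzeta : ErlangC.zeta n lam mu = -z := by
    rw [hz, ErlangC.zeta]; ring
  refine ⟨ErlangC.exists_isTransitionFunction n hlam hmu,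
    ErlangC.isProbabilityMeasure_diffusionLaw hmu.ne' hz0 hzeta,
    ErlangC.integrable_diffusionLaw hmu.ne' hz0 hzeta, fun P hP =>
    ⟨ErlangC.existsUnique_isStationary hn hlam hmu hRn hP, fun π hπ => ?_⟩⟩
  have hprob := hπ.1
  have hbal := hπ.balance hmu hP
  have ha1 := ErlangC.hasSum_real_singleton π
  have hint : ∀ h : ℝ → ℝ, LipschitzWith 1 h →
      Integrable (fun k : ℕ => h (((k : ℝ) - lam / mu) / √(lam / mu))) π := by
    intro h hh
    have := (ErlangC.abs_tsum_sub_le hR hRn (fun k => measureReal_nonneg) ha1 hbal hδ hδR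
      hz hh).1.abs
    simp only [ErlangC.grid, mul_one_div, abs_mul, abs_of_nonneg measureReal_nonneg] at this
    exact ErlangC.integrable_nat_iff.2 this
  have hmean : Integrable (fun k : ℕ => (k : ℝ)) π := by
    have h := ((hint id LipschitzWith.id).mul_const √(lam / mu)).add
      (integrable_const (lam / mu))
    refine h.congr (ae_of_all _ fun k => ?_)
    simp only [id, Pi.add_apply]
    rw [div_mul_cancel₀ _ hsq.ne', sub_add_cancel]
  have hmain : ∀ h : ℝ → ℝ, LipschitzWith 1 h →
      |∫ k : ℕ, h (((k : ℝ) - lam / mu) / √(lam / mu)) ∂π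
        - ∫ x, h x ∂(ErlangC.diffusionLaw n lam mu)| ≤ 205 / √(lam / mu) := by
    intro h hh
    obtain ⟨-, hb⟩ := ErlangC.abs_tsum_sub_le hR hRn (fun k => measureReal_nonneg) ha1 hbal hδ hδR
      hz hh
    rw [integral_countable (hint h hh), ErlangC.integral_diffusionLaw hmu.ne' hz0 hzeta]
    simp only [ErlangC.grid, mul_one_div] at hb
    simp only [smul_eq_mul]
    -- The constant obtained is 30, weakened here to 205.
    refine hb.trans ?_
    gcongr
    norm_num
  refine ⟨hmean, ?_, ?_⟩
  · refine iSup₂_le fun h hh => ENNReal.ofReal_le_ofReal ?_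
    rw [ErlangC.scaledLaw, integral_map (measurable_of_countable _).aemeasurable
      hh.continuous.aestronglyMeasurable]
    exact hmain h hh
  -- The identity is 1-Lipschitz; multiplying its bound by √R gives the statement on means.
  · have h := hmain id LipschitzWith.id
    simp only [id] at h
    rw [integral_div, integral_sub hmean (integrable_const _)] at h
    simp only [integral_const, probReal_univ, one_smul] at h
    rw [le_div_iff₀ hsq, ← abs_of_pos hsq, ← abs_mul, abs_of_pos hsq] at h
    refine le_trans (le_of_eq ?_) h
    congr 1
    field_simp
    ring
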